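/- **Theorem.** Let $U\in C^2(\mathbb R)$ be a double-well potential: for some $x_-<x_0<x_+$ it has local minima at $x_\pm$ and a local maximum at $x_0$, with $U''\neq 0$ at these three points. Let $V>c_0>c_1>v$, where $V$ and $v$ are, respectively, a local maximum value and a local minimum value of $U'$. Let $a_-<a_0<a_+$ be the critical points of $U_1(y)=U(y)-c_1y$ and $b_-<b_0<b_+$ the critical points of $U_0(y)=U(y)-c_0y$ (each of $U_0$, $U_1$ has precisely three critical points), the value $V$ being attained at a local maximum point of $U'$ lying in $(a_-,a_0)\cap(b_-,b_0)$ and the value $v$ at a local minimum point of $U'$ lying in $(a_0,a_+)\cap(b_0,b_+)$. Let $\xi=\xi(t)\in\{0,1\}$, $t\ge 0$, be a two-state Markov process with right-continuous paths and switching intensities $\lambda_0>0$ (from $0$ to $1$) and $\lambda_1>0$ (from $1$ to $0$). Let $x\in(b_0,a_0)$ and let $X$ be the process with continuous paths on $[0,\infty)$ that solves $$X(t)=x-\int_0^tU'(X(s))\,ds+\int_0^tc_{\xi(s)}\,ds,\qquad t\ge0.$$ Put $\mathcal T(x,a_0)=\inf\{t>0: X(t)=a_0\}$ (with $\inf\emptyset=\infty$)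 and $$p_i(x)=\mathbb P\{\mathcal T(x,a_0)<\infty\mid \xi(0)=i\},\qquad i\in\{0,1\}.$$ Let $\Phi_0,\Phi_1$ be any functions on $(b_0,a_0)$ with $\Phi_i'(y)=1/(c_i-U'(y))$, and let $\Psi=\exp(\lambda_0\Phi_0+\lambda_1\Phi_1)$. Then the integrals $$B_i=\int_{b_0}^{a_0}\frac{\Psi(y)}{c_i-U'(y)}\,dy,\qquad i\in\{0,1\},$$ converge absolutely and are nonzero, and $$p_0(x)=1-B_0^{-1}\int_x^{a_0}\frac{\Psi(y)}{c_0-U'(y)}\,dy,\qquad p_1(x)=B_1^{-1}\int_{b_0}^{x}\frac{\Psi(y)}{c_1-U'(y)}\,dy,$$ where the formula for $p_i$ is asserted whenever $\mathbb P\{\xi(0)=i\}>0$. -/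

import Mathlib

open MeasureTheory ProbabilityTheory Set

noncomputable section

/-- `U` is a twice continuously differentiable double-well potential: nondegenerate local minima
at `xm` and `xp`, separated by a nondegenerate local maximum at `x0`. -/
structure IsDoubleWell (U : ℝ → ℝ) (xm x0 xp : ℝ) : Prop where
  contDiff : ContDiff ℝ 2 U
  lt_left : xm < x0
  lt_right : x0 < xp
  min_left : IsLocalMin U xm
  max_mid : IsLocalMax U x0
  min_right : IsLocalMin U xp
  nondeg_left : deriv (deriv U) xm ≠ 0
  nondeg_mid : deriv (deriv U) x0 ≠ 0
  nondeg_right : deriv (deriv U) xp ≠ 0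

/-- The critical points of the tilted potential `y ↦ U y - k * y`, i.e. the solutions of
`U' y = k`, are precisely the three numbers `p < q < r`. -/
structure IsCriticalTriple (U : ℝ → ℝ) (k p q r : ℝ) : Prop where
  lt_left : p < q
  lt_right : q < r
  critical_iff : ∀ y : ℝ, deriv U y = k ↔ y = p ∨ y = q ∨ y = r

/-- The small-velocity regime `V > c₀ > c₁ > v`. Here `V` and `v` are a local maximum and a local
minimum of `U'`; the critical points of `U₁ = U - c₁ y` are `am < a0 < ap`, those of
`U₀ = U - c₀ y` are `bm < b0 < bp`; and the local maximum (minimum) of `U'` is attained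
between the lower two (upper two) critical points of each of `U₀` and `U₁`. -/
structure IsSmallVelocityRegime (U : ℝ → ℝ) (c : Fin 2 → ℝ) (V v : ℝ)
    (am a0 ap bm b0 bp : ℝ) : Prop where
  v_lt : v < c 1
  c_lt : c 1 < c 0
  lt_V : c 0 < V
  critical_one : IsCriticalTriple U (c 1) am a0 ap
  critical_zero : IsCriticalTriple U (c 0) bm b0 bp
  exists_max : ∃ y ∈ Ioo am a0 ∩ Ioo bm b0, IsLocalMax (deriv U) y ∧ deriv U y = V
  exists_min : ∃ y ∈ Ioo a0 ap ∩ Ioo b0 bp, IsLocalMin (deriv U) y ∧ deriv U y = v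

/-- The state, after `n` switchings, of an alternating two-state system started from `i`. -/
def alternate (i : Fin 2) (n : ℕ) : Fin 2 := if Even n then i else 1 - i

/-- `ξ = (ξ t)`, `t ≥ 0`, is a (right-continuous) two-state Markov process with
switching intensities `lam 0` (from `0` to `1`) and `lam 1` (from `1` to `0`): given
the initial state, the successive holding times `σ 0, σ 1, …` are independent, the holding time
in a state `j` being exponentially distributed with rate `lam j`, and `ξ` changes its state at the
times `σ 0`, `σ 0 + σ 1`, …. The law of `ξ 0` is arbitrary. -/
structure IsTwoStateMarkov {Ω : Type*} [MeasurableSpace Ω] (P : Measure Ω) (lam : Fin 2 → ℝ)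
    (ξ : ℝ → Ω → Fin 2) : Prop where
  measurable : ∀ t : ℝ, 0 ≤ t → Measurable (ξ t)
  exists_holding : ∃ σ : ℕ → Ω → ℝ,
    (∀ n, Measurable (σ n)) ∧
    (∀ i : Fin 2, P {ω | ξ 0 ω = i} ≠ 0 →
      iIndepFun σ P[|{ω | ξ 0 ω = i}] ∧
      ∀ n, (P[|{ω | ξ 0 ω = i}]).map (σ n) = expMeasure (lam (alternate i n))) ∧
    ∀ᵐ ω ∂P, ∀ (n : ℕ) (t : ℝ), ∑ k ∈ Finset.range n, σ k ω ≤ t →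
      t < ∑ k ∈ Finset.range (n + 1), σ k ω → ξ t ω = alternate (ξ 0 ω) n

/-- The telegraph process `𝕋(t) = ∫₀ᵗ c_{ξ(s)} ds`. -/
def telegraph {Ω : Type*} (c : Fin 2 → ℝ) (ξ : ℝ → Ω → Fin 2) (t : ℝ) (ω : Ω) : ℝ :=
  ∫ s in (0 : ℝ)..t, c (ξ s ω)

/-- `X = (X t)`, `t ≥ 0`, is the telegraph process in the potential `U`, started from `x`:
a process with continuous paths and `dX(t) = -U'(X(t)) dt + d𝕋(t)`, `X(0) = x`. -/
structure IsTelegraphInPotential {Ω : Type*} [MeasurableSpace Ω] (P : Measure Ω)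
    (U : ℝ → ℝ) (c : Fin 2 → ℝ) (ξ : ℝ → Ω → Fin 2) (x : ℝ) (X : ℝ → Ω → ℝ) : Prop where
  measurable : ∀ t : ℝ, 0 ≤ t → Measurable (X t)
  solves : ∀ᵐ ω ∂P, ContinuousOn (fun t => X t ω) (Ici 0) ∧
    ∀ t : ℝ, 0 ≤ t →
      X t ω = x - (∫ s in (0 : ℝ)..t, deriv U (X s ω)) + telegraph c ξ t ω

/-- The first passage time `inf {t > 0 | X t = y}`, with value `∞` if there is no such `t`. -/
def firstPassage {Ω : Type*} (X : ℝ → Ω → ℝ) (y : ℝ) (ω : Ω) : ENNReal :=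
  ⨅ (t : ℝ) (_ : 0 < t) (_ : X t ω = y), ENNReal.ofReal t

/-- `Ψ = exp (λ₀ Φ₀ + λ₁ Φ₁)`. -/
def Psi (lam : Fin 2 → ℝ) (Φ : Fin 2 → ℝ → ℝ) (y : ℝ) : ℝ :=
  Real.exp (lam 0 * Φ 0 y + lam 1 * Φ 1 y)

/-- The integrand `Ψ(y) / (c_i - U'(y))`. -/
def exitDensity (U : ℝ → ℝ) (c lam : Fin 2 → ℝ) (Φ : Fin 2 → ℝ → ℝ) (i : Fin 2) (y : ℝ) : ℝ :=
  Psi lam Φ y / (c i - deriv U y)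

/-- The normalising integral `B_i = ∫_{b₀}^{a₀} Ψ(y) / (c_i - U'(y)) dy`. -/
def exitB (U : ℝ → ℝ) (c lam : Fin 2 → ℝ) (Φ : Fin 2 → ℝ → ℝ) (b0 a0 : ℝ) (i : Fin 2) : ℝ :=
  ∫ y in b0..a0, exitDensity U c lam Φ i y

/-- `p_i = ℙ {𝒯(x, a) < ∞ | ξ(0) = i}` for the process `X` started from `x`. -/
def hitProb {Ω : Type*} [MeasurableSpace Ω] (P : Measure Ω) (ξ : ℝ → Ω → Fin 2)
    (X : ℝ → Ω → ℝ) (a : ℝ) (i : Fin 2) : ℝ :=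
  (P[|{ω | ξ 0 ω = i}]).real {ω | firstPassage X a ω < ⊤}

end

open Filter Topology

/-! Write `l = b₀`, `r = a₀` and `v_j = c_j - U'`. On `(l, r)` the drift `v_0` is positive and
vanishes at `l`, while `v_1` is negative and vanishes at `r`. A motion inside `(l, r)` can therefore
leave only through `r` in state 0 and only through `l` in state 1. The exit probabilities `u_j`
through `r` should solve the backward system `v_j u_j' = λ_j (u_j - u_{1-j})` with boundary values 0
at `l` and 1 at `r`. Since `Ψ' = λ_0 Ψ / v_0 + λ_1 Ψ / v_1` and `Ψ` vanishes at both ends, the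
normalised primitives `u_j = B_j⁻¹ ∫_l^y Ψ / v_j` do so (`exitScale_sub`, `hasDerivAt_exitScale`).

That these functions are the probabilities is checked on the chain of positions at the switching
times, stopped at the ends. Integrating the backward system along the flow against an exponential
time shows that one step of the chain preserves the mean of the scale function of the current state
(`integral_exitScale_stoppedFlow`). Two consecutive steps leave the interval with probability
bounded below (`exists_survival_two_steps_le`), so the chain is absorbed almost surely. Dominated
convergence then identifies `u_i(x)` with the probability of absorption at `r`
(`measureReal_exists_stoppedChain_eq`).

It remains to return to `X`, which keeps moving after it has reached `l`. It can never reach `r`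
afterwards: its increments are at most those produced by `v_0`, and `v_0 = O(y - l)`, so Gronwall's
inequality forbids crossing from `l` to `r` (`lt_right_of_le_left`). Hence `X` hits `r` exactly when
the chain is absorbed there (`exists_stoppedChain_eq_iff`). -/

/-- Two continuous drifts on `(l, r)`, the first one positive, the second one negative, such that
the first does not vanish at `r`, the second does not vanish at `l`, and each drift is
`O(distance)` at the endpoint it points away from. -/
structure OpposedDrifts (v : Fin 2 → ℝ → ℝ) (l r : ℝ) : Prop where
  lt : l < r
  continuous : ∀ j, Continuous (v j)
  pos : ∀ y ∈ Ioo l r, 0 < v 0 y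
  neg : ∀ y ∈ Ioo l r, v 1 y < 0
  pos_right : 0 < v 0 r
  neg_left : v 1 l < 0
  linear_bound : ∃ L > 0, ∀ y ∈ Ioo l r, v 0 y ≤ L * (y - l) ∧ -v 1 y ≤ L * (r - y)

/-- `Φ j` is a travel-time coordinate for the drift `v j` on `(l, r)`. -/
def IsTravelTime (v : Fin 2 → ℝ → ℝ) (Φ : Fin 2 → ℝ → ℝ) (l r : ℝ) : Prop :=
  ∀ j, ∀ y ∈ Ioo l r, HasDerivAt (Φ j) (1 / v j y) y

/-! ### Travel-time coordinates and their behaviour at the endpoints -/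

namespace OpposedDrifts

variable {v Φ : Fin 2 → ℝ → ℝ} {l r : ℝ}

/-- The map `y ↦ -y`, combined with exchanging the two states, is a symmetry of the setting. It
turns each fact about `Φ 0` into the mirror fact about `Φ 1`. -/
theorem reflect (h : OpposedDrifts v l r) :
    OpposedDrifts (fun j y => -v (1 - j) (-y)) (-r) (-l) where
  lt := neg_lt_neg h.lt
  continuous j := ((h.continuous (1 - j)).comp continuous_neg).neg
  pos y hy := by
    have := h.neg (-y) ⟨by linarith [hy.2], by linarith [hy.1]⟩
    simpa using this
  neg y hy := by
    have := h.pos (-y) ⟨by linarith [hy.2], by linarith [hy.1]⟩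
    simpa using this
  pos_right := by simpa using h.neg_left
  neg_left := by simpa using h.pos_right
  linear_bound := by
    obtain ⟨L, hL, H⟩ := h.linear_bound
    refine ⟨L, hL, fun y hy => ?_⟩
    have := H (-y) ⟨by linarith [hy.2], by linarith [hy.1]⟩
    constructor
    · simpa [sub_eq_add_neg, add_comm] using this.2
    · simpa [sub_eq_add_neg, add_comm] using this.1

theorem _root_.IsTravelTime.reflect (hΦ : IsTravelTime v Φ l r) :
    IsTravelTime (fun j y => -v (1 - j) (-y)) (fun j y => Φ (1 - j) (-y)) (-r) (-l) := by
  intro j y hy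
  have := (hΦ (1 - j) (-y) ⟨by linarith [hy.2], by linarith [hy.1]⟩).comp y (hasDerivAt_neg y)
  refine this.congr_deriv ?_
  simp only [mul_neg_one, div_neg]

theorem ne_zero (h : OpposedDrifts v l r) (j : Fin 2) {y : ℝ} (hy : y ∈ Ioo l r) : v j y ≠ 0 := by
  fin_cases j
  · exact (h.pos y hy).ne'
  · exact (h.neg y hy).ne

theorem _root_.IsTravelTime.continuousOn (hΦ : IsTravelTime v Φ l r) (j : Fin 2) :
    ContinuousOn (Φ j) (Ioo l r) :=
  fun y hy => (hΦ j y hy).continuousAt.continuousWithinAt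

theorem strictMonoOn (h : OpposedDrifts v l r) (hΦ : IsTravelTime v Φ l r) :
    StrictMonoOn (Φ 0) (Ioo l r) := by
  refine strictMonoOn_of_deriv_pos (convex_Ioo l r) (hΦ.continuousOn 0) fun y hy => ?_
  rw [interior_Ioo] at hy
  rw [(hΦ 0 y hy).deriv]
  exact one_div_pos.2 (h.pos y hy)

theorem strictAntiOn (h : OpposedDrifts v l r) (hΦ : IsTravelTime v Φ l r) :
    StrictAntiOn (Φ 1) (Ioo l r) := by
  refine strictAntiOn_of_deriv_neg (convex_Ioo l r) (hΦ.continuousOn 1) fun y hy => ?_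
  rw [interior_Ioo] at hy
  rw [(hΦ 1 y hy).deriv]
  exact one_div_neg.2 (h.neg y hy)

theorem injOn (h : OpposedDrifts v l r) (hΦ : IsTravelTime v Φ l r) (j : Fin 2) :
    InjOn (Φ j) (Ioo l r) := by
  fin_cases j
  · exact (h.strictMonoOn hΦ).injOn
  · exact (h.strictAntiOn hΦ).injOn

/-- The end `r` is reached in finite time: `1 / v 0` stays bounded near `r` because `v 0` does not
vanish there. -/
theorem bddAbove_zero (h : OpposedDrifts v l r) (hΦ : IsTravelTime v Φ l r) :
    ∃ C, ∀ y ∈ Ioo l r, Φ 0 y ≤ C := by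
  obtain ⟨m, hm⟩ := exists_between h.lt
  have hpos : ∀ y ∈ Icc m r, 0 < v 0 y := by
    intro y hy
    rcases hy.2.lt_or_eq with h1 | h1
    · exact h.pos y ⟨hm.1.trans_le hy.1, h1⟩
    · rw [h1]; exact h.pos_right
  obtain ⟨M, hM⟩ := (isCompact_Icc (a := m) (b := r)).exists_bound_of_continuousOn
    (f := fun y => 1 / v 0 y) (continuousOn_const.div (h.continuous 0).continuousOn
      fun y hy => (hpos y hy).ne')
  have hM0 : 0 ≤ M := (norm_nonneg _).trans (hM m ⟨le_rfl, hm.2.le⟩)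
  refine ⟨Φ 0 m + M * (r - m), fun y hy => ?_⟩
  rcases le_total y m with hym | hym
  · have h1 := (h.strictMonoOn hΦ).monotoneOn hy hm hym
    nlinarith [hm.2]
  · have hsub : Icc m y ⊆ Ioo l r := fun z hz => ⟨hm.1.trans_le hz.1, hz.2.trans_lt hy.2⟩
    have := (convex_Icc m y).image_sub_le_mul_sub_of_deriv_le (f := Φ 0) (C := M)
      ((hΦ.continuousOn 0).mono hsub)
      (fun z hz => ((hΦ 0 z (hsub (interior_subset hz))).differentiableAt).differentiableWithinAt)
      (fun z hz => by
        have hz' := interior_subset hz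
        rw [(hΦ 0 z (hsub hz')).deriv]
        exact (le_abs_self _).trans (hM z ⟨hz'.1, hz'.2.trans hy.2.le⟩))
      m ⟨le_rfl, hym⟩ y ⟨hym, le_rfl⟩ hym
    nlinarith [hy.2]

theorem exists_upper_bound (h : OpposedDrifts v l r) (hΦ : IsTravelTime v Φ l r) (j : Fin 2) :
    ∃ C, ∀ y ∈ Ioo l r, Φ j y ≤ C := by
  fin_cases j
  · exact h.bddAbove_zero hΦ
  · obtain ⟨C, hC⟩ := h.reflect.bddAbove_zero hΦ.reflect
    refine ⟨C, fun y hy => ?_⟩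
    have := hC (-y) ⟨by linarith [hy.2], by linarith [hy.1]⟩
    simpa using this

/-- The end `l` is infinitely far in the past: `1 / v 0 ≥ 1 / (L (y - l))`, so `Φ 0` falls at least
as fast as `L⁻¹ log (y - l)`. -/
theorem tendsto_left (h : OpposedDrifts v l r) (hΦ : IsTravelTime v Φ l r) :
    Tendsto (Φ 0) (𝓝[>] l) atBot := by
  obtain ⟨m, hm⟩ := exists_between h.lt
  obtain ⟨L, hL, H⟩ := h.linear_bound
  have hder : ∀ y ∈ Ioo l r,
      HasDerivAt (fun y => Φ 0 y - L⁻¹ * Real.log (y - l)) (1 / v 0 y - L⁻¹ * (1 / (y - l))) y := by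
    intro y hy
    refine (hΦ 0 y hy).sub (HasDerivAt.const_mul _ ?_)
    exact ((hasDerivAt_id y).sub_const l).log (sub_pos.2 hy.1).ne'
  have hmono : MonotoneOn (fun y => Φ 0 y - L⁻¹ * Real.log (y - l)) (Ioo l r) := by
    refine monotoneOn_of_deriv_nonneg (convex_Ioo l r)
      (fun y hy => (hder y hy).continuousAt.continuousWithinAt)
      (fun y hy => (hder y (interior_subset hy)).differentiableAt.differentiableWithinAt)
      fun y hy => ?_
    have hy' := interior_subset hy
    rw [(hder y hy').deriv, sub_nonneg, ← one_div, one_div_mul_one_div]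
    exact one_div_le_one_div_of_le (h.pos y hy') (H y hy').1
  have hlog : Tendsto (fun y => Φ 0 m - L⁻¹ * Real.log (m - l) + L⁻¹ * Real.log (y - l))
      (𝓝[>] l) atBot := by
    refine tendsto_atBot_add_const_left _ _ (Tendsto.const_mul_atBot (inv_pos.2 hL) ?_)
    have hsub : Tendsto (fun y => y - l) (𝓝[>] l) (𝓝[>] 0) := by
      refine tendsto_nhdsWithin_iff.2 ⟨?_, ?_⟩
      · have hc : Continuous fun y : ℝ => y - l := by fun_prop
        exact (hc.tendsto' l 0 (sub_self l)).mono_left nhdsWithin_le_nhds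
      · filter_upwards [self_mem_nhdsWithin] with y hy
        exact sub_pos.2 (mem_Ioi.1 hy)
    exact Real.tendsto_log_nhdsGT_zero.comp hsub
  refine tendsto_atBot_mono' _ ?_ hlog
  filter_upwards [Ioo_mem_nhdsGT hm.1] with y hy
  have := hmono ⟨hy.1, hy.2.trans hm.2⟩ hm hy.2.le
  simp only at this
  linarith

theorem tendsto_right (h : OpposedDrifts v l r) (hΦ : IsTravelTime v Φ l r) :
    Tendsto (Φ 1) (𝓝[<] r) atBot := by
  have h1 := h.reflect.tendsto_left hΦ.reflect
  have h2 : Tendsto (fun y : ℝ => -y) (𝓝[<] r) (𝓝[>] (-r)) := tendsto_neg_nhdsLT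
  have := h1.comp h2
  simpa [Function.comp_def] using this

/-- Up to the factor `a`, the integrand is the derivative of the bounded increasing function `exp (a
Φ 0)`, and the derivative of a monotone function is integrable. No rate for `v 0` near `l` is
needed. -/
theorem integrableOn_exp_div_zero (h : OpposedDrifts v l r) (hΦ : IsTravelTime v Φ l r)
    {a : ℝ} (ha : 0 < a) :
    IntegrableOn (fun y => Real.exp (a * Φ 0 y) / v 0 y) (Ioo l r) := by
  obtain ⟨C, hC⟩ := h.bddAbove_zero hΦ
  -- The values 0 and `exp (a C)` at the ends keep the extension monotone on the closed interval.
  set g : ℝ → ℝ := fun y =>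
    if y ≤ l then 0 else if y < r then Real.exp (a * Φ 0 y) else Real.exp (a * C) with hg
  have hmono : MonotoneOn g (uIcc l r) := by
    intro y hy z hz hyz
    simp only [hg]
    split_ifs with h1 h2 h3 h4 h5 h6 h7 <;> try linarith
    all_goals first | positivity | skip
    · exact Real.exp_le_exp.2 (mul_le_mul_of_nonneg_left
        ((h.strictMonoOn hΦ).monotoneOn ⟨not_le.1 h1, h4⟩ ⟨not_le.1 (by assumption), by assumption⟩
          hyz) ha.le)
    · exact Real.exp_le_exp.2 (mul_le_mul_of_nonneg_left (hC y ⟨not_le.1 h1, h4⟩) ha.le)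
  have hint := hmono.intervalIntegrable_deriv
  rw [intervalIntegrable_iff_integrableOn_Ioo_of_le h.lt.le] at hint
  refine (hint.const_mul a⁻¹).congr ?_
  filter_upwards [ae_restrict_mem measurableSet_Ioo] with y hy
  have hd : HasDerivAt g (Real.exp (a * Φ 0 y) * (a * (1 / v 0 y))) y := by
    refine (((hΦ 0 y hy).const_mul a).exp).congr_of_eventuallyEq ?_
    filter_upwards [Ioo_mem_nhds hy.1 hy.2] with z hz
    simp [hg, not_le.2 hz.1, hz.2]
  rw [hd.deriv]
  field_simp

theorem integrableOn_exp_div (h : OpposedDrifts v l r) (hΦ : IsTravelTime v Φ l r)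
    {a : ℝ} (ha : 0 < a) (j : Fin 2) :
    IntegrableOn (fun y => Real.exp (a * Φ j y) / v j y) (Ioo l r) := by
  fin_cases j
  · exact h.integrableOn_exp_div_zero hΦ ha
  · have h1 := h.reflect.integrableOn_exp_div_zero hΦ.reflect ha
    have h2 := ((Measure.measurePreserving_neg (volume : Measure ℝ)).integrableOn_comp_preimage
      (Homeomorph.neg ℝ).measurableEmbedding).2 h1
    have h3 : (Neg.neg ⁻¹' Ioo (-r) (-l) : Set ℝ) = Ioo l r := by
      ext y; simp
    rw [h3] at h2
    refine h2.neg.congr (ae_of_all _ fun y => ?_)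
    simp [div_neg]

/-! ### The function `Ψ` and the integrals `B_j` -/

variable {lam : Fin 2 → ℝ}

theorem psi_eq (lam : Fin 2 → ℝ) (Φ : Fin 2 → ℝ → ℝ) (j : Fin 2) (y : ℝ) :
    Psi lam Φ y = Real.exp (lam j * Φ j y) * Real.exp (lam (1 - j) * Φ (1 - j) y) := by
  rw [Psi, ← Real.exp_add]
  fin_cases j
  · simp
  · simp [add_comm]

theorem integrableOn_psi_div (h : OpposedDrifts v l r) (hΦ : IsTravelTime v Φ l r)
    (hlam : ∀ j, 0 < lam j) (j : Fin 2) :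
    IntegrableOn (fun y => Psi lam Φ y / v j y) (Ioo l r) := by
  obtain ⟨C, hC⟩ := h.exists_upper_bound hΦ (1 - j)
  have hm : AEStronglyMeasurable (fun y => Real.exp (lam (1 - j) * Φ (1 - j) y))
      (volume.restrict (Ioo l r)) :=
    ((continuousOn_const.mul (hΦ.continuousOn (1 - j))).rexp).aestronglyMeasurable
      measurableSet_Ioo
  have := (h.integrableOn_exp_div hΦ (hlam j) j).mul_bdd (c := Real.exp (lam (1 - j) * C)) hm (by
    filter_upwards [ae_restrict_mem measurableSet_Ioo] with y hy
    rw [Real.norm_eq_abs, Real.abs_exp]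
    exact Real.exp_le_exp.2 (mul_le_mul_of_nonneg_left (hC y hy) (hlam _).le))
  refine this.congr (ae_of_all _ fun y => ?_)
  simp only [psi_eq lam Φ j y]
  ring

theorem hasDerivAt_psi (hΦ : IsTravelTime v Φ l r) {y : ℝ} (hy : y ∈ Ioo l r) :
    HasDerivAt (Psi lam Φ)
      (lam 0 * (Psi lam Φ y / v 0 y) + lam 1 * (Psi lam Φ y / v 1 y)) y := by
  have := (((hΦ 0 y hy).const_mul (lam 0)).add ((hΦ 1 y hy).const_mul (lam 1))).exp
  refine this.congr_deriv ?_
  simp only [Psi, Pi.add_apply]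
  ring

/-- One exponential factor of `Ψ` tends to 0 while the other stays bounded, as both coordinates are
bounded above. -/
theorem tendsto_psi_of_atBot (h : OpposedDrifts v l r) (hΦ : IsTravelTime v Φ l r)
    (hlam : ∀ j, 0 < lam j) (j : Fin 2) {F : Filter ℝ} (hF : ∀ᶠ y in F, y ∈ Ioo l r)
    (ht : Tendsto (Φ j) F atBot) : Tendsto (Psi lam Φ) F (𝓝 0) := by
  obtain ⟨C, hC⟩ := h.exists_upper_bound hΦ (1 - j)
  have h1 : Tendsto (fun y => Real.exp (lam j * Φ j y) * Real.exp (lam (1 - j) * C)) F (𝓝 0) := by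
    have := (Real.tendsto_exp_atBot.comp (ht.const_mul_atBot (hlam j))).mul_const
      (Real.exp (lam (1 - j) * C))
    simpa [Function.comp_def] using this
  refine squeeze_zero' (Eventually.of_forall fun y => (Real.exp_pos _).le) ?_ h1
  filter_upwards [hF] with y hy
  rw [psi_eq lam Φ j y]
  exact mul_le_mul_of_nonneg_left (Real.exp_le_exp.2
    (mul_le_mul_of_nonneg_left (hC y hy) (hlam _).le)) (Real.exp_pos _).le

theorem tendsto_psi_left (h : OpposedDrifts v l r) (hΦ : IsTravelTime v Φ l r)
    (hlam : ∀ j, 0 < lam j) : Tendsto (Psi lam Φ) (𝓝[>] l) (𝓝 0) :=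
  h.tendsto_psi_of_atBot hΦ hlam 0 (Ioo_mem_nhdsGT h.lt) (h.tendsto_left hΦ)

theorem tendsto_psi_right (h : OpposedDrifts v l r) (hΦ : IsTravelTime v Φ l r)
    (hlam : ∀ j, 0 < lam j) : Tendsto (Psi lam Φ) (𝓝[<] r) (𝓝 0) :=
  h.tendsto_psi_of_atBot hΦ hlam 1 (Ioo_mem_nhdsLT h.lt) (h.tendsto_right hΦ)

theorem intervalIntegrable_psi_div (h : OpposedDrifts v l r) (hΦ : IsTravelTime v Φ l r)
    (hlam : ∀ j, 0 < lam j) (j : Fin 2) {a b : ℝ} (ha : a ∈ Icc l r) (hb : b ∈ Icc l r) :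
    IntervalIntegrable (fun y => Psi lam Φ y / v j y) volume a b := by
  have h1 := (intervalIntegrable_iff_integrableOn_Ioo_of_le h.lt.le).2
    (h.integrableOn_psi_div hΦ hlam j)
  refine h1.mono_set ?_
  rw [uIcc_of_le h.lt.le]
  exact uIcc_subset_Icc ha hb

/-- This is the integral of `Ψ'`, and `Ψ` vanishes at both ends. It ties `B_1` to `B_0`, which makes
`B_1` nonzero and matches the two scale functions. -/
theorem psi_balance (h : OpposedDrifts v l r) (hΦ : IsTravelTime v Φ l r)
    (hlam : ∀ j, 0 < lam j) :
    lam 0 * (∫ z in l..r, Psi lam Φ z / v 0 z) + lam 1 * (∫ z in l..r, Psi lam Φ z / v 1 z)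
      = 0 := by
  have hi := fun j => h.intervalIntegrable_psi_div hΦ hlam j (left_mem_Icc.2 h.lt.le)
    (right_mem_Icc.2 h.lt.le)
  rw [← intervalIntegral.integral_const_mul, ← intervalIntegral.integral_const_mul,
    ← intervalIntegral.integral_add ((hi 0).const_mul _) ((hi 1).const_mul _),
    intervalIntegral.integral_eq_sub_of_hasDerivAt_of_tendsto h.lt
      (fun y hy => hasDerivAt_psi hΦ hy) (((hi 0).const_mul _).add ((hi 1).const_mul _))
      (h.tendsto_psi_left hΦ hlam) (h.tendsto_psi_right hΦ hlam), sub_zero]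

theorem psi_eq_integral (h : OpposedDrifts v l r) (hΦ : IsTravelTime v Φ l r)
    (hlam : ∀ j, 0 < lam j) {y : ℝ} (hy : y ∈ Ioo l r) :
    lam 0 * (∫ z in l..y, Psi lam Φ z / v 0 z) + lam 1 * (∫ z in l..y, Psi lam Φ z / v 1 z)
      = Psi lam Φ y := by
  have hi := fun j => h.intervalIntegrable_psi_div hΦ hlam j (left_mem_Icc.2 h.lt.le)
    (Ioo_subset_Icc_self hy)
  rw [← intervalIntegral.integral_const_mul, ← intervalIntegral.integral_const_mul,
    ← intervalIntegral.integral_add ((hi 0).const_mul _) ((hi 1).const_mul _),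
    intervalIntegral.integral_eq_sub_of_hasDerivAt_of_tendsto hy.1
      (fun z hz => hasDerivAt_psi hΦ ⟨hz.1, hz.2.trans hy.2⟩)
      (((hi 0).const_mul _).add ((hi 1).const_mul _))
      (h.tendsto_psi_left hΦ hlam)
      ((hasDerivAt_psi hΦ hy).continuousAt.tendsto.mono_left nhdsWithin_le_nhds), sub_zero]

theorem integral_pos_zero (h : OpposedDrifts v l r) (hΦ : IsTravelTime v Φ l r)
    (hlam : ∀ j, 0 < lam j) : 0 < ∫ z in l..r, Psi lam Φ z / v 0 z :=
  intervalIntegral.intervalIntegral_pos_of_pos_on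
    (h.intervalIntegrable_psi_div hΦ hlam 0 (left_mem_Icc.2 h.lt.le) (right_mem_Icc.2 h.lt.le))
    (fun y hy => div_pos (Real.exp_pos _) (h.pos y hy)) h.lt

theorem integral_ne_zero (h : OpposedDrifts v l r) (hΦ : IsTravelTime v Φ l r)
    (hlam : ∀ j, 0 < lam j) (j : Fin 2) : ∫ z in l..r, Psi lam Φ z / v j z ≠ 0 := by
  have h0 := h.integral_pos_zero hΦ hlam
  have h1 := h.psi_balance hΦ hlam
  fin_cases j
  · exact h0.ne'
  · intro h2
    simp only [Fin.mk_one] at h2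
    rw [h2, mul_zero, add_zero] at h1
    exact (mul_pos (hlam 0) h0).ne' h1

end OpposedDrifts

/-! ### Scale functions and the backward system -/

/-- The normalised scale function `y ↦ (∫_l^r Ψ / v_j)⁻¹ ∫_l^y Ψ / v_j`, extended by constants
outside `(l, r)`. -/
noncomputable def exitScale (v Φ : Fin 2 → ℝ → ℝ) (lam : Fin 2 → ℝ) (l r : ℝ) (j : Fin 2) (y : ℝ) :
    ℝ :=
  (∫ z in l..r, Psi lam Φ z / v j z)⁻¹ *
    ∫ z in l..y, (Ioo l r).indicator (fun z => Psi lam Φ z / v j z) z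

namespace OpposedDrifts

variable {v Φ : Fin 2 → ℝ → ℝ} {l r : ℝ} {lam : Fin 2 → ℝ}

theorem exitScale_eq (j : Fin 2) {y : ℝ} (hy : y ∈ Icc l r) :
    exitScale v Φ lam l r j y =
      (∫ z in l..r, Psi lam Φ z / v j z)⁻¹ * ∫ z in l..y, Psi lam Φ z / v j z := by
  rw [exitScale]
  congr 1
  rw [intervalIntegral.integral_of_le hy.1, intervalIntegral.integral_of_le hy.1,
    integral_Ioc_eq_integral_Ioo, integral_Ioc_eq_integral_Ioo]
  refine setIntegral_congr_fun measurableSet_Ioo fun z hz => ?_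
  exact indicator_of_mem (show z ∈ Ioo l r from ⟨hz.1, hz.2.trans_le hy.2⟩) _

theorem continuous_exitScale (h : OpposedDrifts v l r) (hΦ : IsTravelTime v Φ l r)
    (hlam : ∀ j, 0 < lam j) (j : Fin 2) : Continuous (exitScale v Φ lam l r j) := by
  refine continuous_const.mul (intervalIntegral.continuous_primitive (fun a b => ?_) l)
  exact ((integrable_indicator_iff measurableSet_Ioo).2
    (h.integrableOn_psi_div hΦ hlam j)).intervalIntegrable

theorem exitScale_left (h : OpposedDrifts v l r) (j : Fin 2) :
    exitScale v Φ lam l r j l = 0 := by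
  rw [exitScale_eq j (left_mem_Icc.2 h.lt.le), intervalIntegral.integral_same, mul_zero]

theorem exitScale_right (h : OpposedDrifts v l r) (hΦ : IsTravelTime v Φ l r)
    (hlam : ∀ j, 0 < lam j) (j : Fin 2) : exitScale v Φ lam l r j r = 1 := by
  rw [exitScale_eq j (right_mem_Icc.2 h.lt.le), inv_mul_cancel₀ (h.integral_ne_zero hΦ hlam j)]

theorem hasDerivAt_exitScale (h : OpposedDrifts v l r) (hΦ : IsTravelTime v Φ l r)
    (hlam : ∀ j, 0 < lam j) (j : Fin 2) {y : ℝ} (hy : y ∈ Ioo l r) :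
    HasDerivAt (exitScale v Φ lam l r j)
      ((∫ z in l..r, Psi lam Φ z / v j z)⁻¹ * (Psi lam Φ y / v j y)) y := by
  have hc : ContinuousOn (fun z => Psi lam Φ z / v j z) (Ioo l r) := fun z hz =>
    ((hasDerivAt_psi hΦ hz).continuousAt.div (h.continuous j).continuousAt
      (h.ne_zero j hz)).continuousWithinAt
  have h1 : HasDerivAt (fun y => ∫ z in l..y, Psi lam Φ z / v j z) (Psi lam Φ y / v j y) y :=
    intervalIntegral.integral_hasDerivAt_right
      (h.intervalIntegrable_psi_div hΦ hlam j (left_mem_Icc.2 h.lt.le) (Ioo_subset_Icc_self hy))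
      (hc.stronglyMeasurableAtFilter isOpen_Ioo y hy) (hc.continuousAt (Ioo_mem_nhds hy.1 hy.2))
  refine (h1.const_mul _).congr_of_eventuallyEq ?_
  filter_upwards [Ioo_mem_nhds hy.1 hy.2] with z hz
  exact exitScale_eq j (Ioo_subset_Icc_self hz)

/-- Together with `hasDerivAt_exitScale` this is the backward system `v_j u_j' = λ_j (u_j -
u_{1-j})`. By `psi_balance`, `λ_{1-j} / B_{1-j} = -λ_j / B_j`, hence the left side is `B_j⁻¹` times
the combination computed in `psi_eq_integral`. -/
theorem exitScale_sub (h : OpposedDrifts v l r) (hΦ : IsTravelTime v Φ l r)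
    (hlam : ∀ j, 0 < lam j) (j : Fin 2) {y : ℝ} (hy : y ∈ Ioo l r) :
    lam j * (exitScale v Φ lam l r j y - exitScale v Φ lam l r (1 - j) y) =
      (∫ z in l..r, Psi lam Φ z / v j z)⁻¹ * Psi lam Φ y := by
  rw [exitScale_eq j (Ioo_subset_Icc_self hy), exitScale_eq (1 - j) (Ioo_subset_Icc_self hy)]
  have hb := h.psi_balance hΦ hlam
  have hy' := h.psi_eq_integral hΦ hlam hy
  have n0 := h.integral_ne_zero hΦ hlam 0
  have n1 := h.integral_ne_zero hΦ hlam 1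
  have l0 := (hlam 0).ne'
  have l1 := (hlam 1).ne'
  fin_cases j
  · simp only [Fin.zero_eta, sub_zero]
    rw [← hy']
    field_simp
    linear_combination (-(∫ z in l..y, Psi lam Φ z / v 1 z)) * hb
  · simp only [Fin.mk_one, sub_self]
    rw [← hy']
    field_simp
    linear_combination (-(∫ z in l..y, Psi lam Φ z / v 0 z)) * hb

end OpposedDrifts

/-! ### The flow stopped at the ends, and exponential times -/

/-- The endpoint of `(l, r)` towards which the drift `j` points. -/
noncomputable def exitPoint (l r : ℝ) (j : Fin 2) : ℝ := if j = 0 then r else l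

/-- The inverse of the restriction of `φ` to `(l, r)`, with the value `e` off the range. -/
noncomputable def travelInverse (φ : ℝ → ℝ) (l r e : ℝ) : ℝ → ℝ :=
  Function.extend ((Ioo l r).domRestrict φ) Subtype.val (fun _ => e)

/-- The position after time `t` of a point started from `y` that moves with the drift whose
travel-time coordinate is `Φ j`, stopped on leaving `(l, r)`. -/
noncomputable def stoppedFlow (Φ : Fin 2 → ℝ → ℝ) (l r : ℝ) (j : Fin 2) (y t : ℝ) : ℝ :=
  open Classical in
  if y ∈ Ioo l r then travelInverse (Φ j) l r (exitPoint l r j) (Φ j y + t) else y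

theorem travelInverse_apply {φ : ℝ → ℝ} {l r e : ℝ} (hφ : InjOn φ (Ioo l r)) {z : ℝ}
    (hz : z ∈ Ioo l r) : travelInverse φ l r e (φ z) = z :=
  (injOn_iff_injective.1 hφ).extend_apply Subtype.val (fun _ => e) ⟨z, hz⟩

theorem travelInverse_of_forall_ne {φ : ℝ → ℝ} {l r e s : ℝ} (hs : ∀ z ∈ Ioo l r, φ z ≠ s) :
    travelInverse φ l r e s = e := by
  refine Function.extend_apply' _ _ _ ?_
  rintro ⟨⟨z, hz⟩, h⟩
  exact hs z hz h

theorem measurable_travelInverse {φ : ℝ → ℝ} {l r e : ℝ} (hφ : InjOn φ (Ioo l r))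
    (hc : ContinuousOn φ (Ioo l r)) : Measurable (travelInverse φ l r e) :=
  (hc.measurableEmbedding measurableSet_Ioo hφ).measurable_extend measurable_subtype_coe
    measurable_const

theorem integral_expMeasure {a : ℝ} (ha : 0 < a) (g : ℝ → ℝ) :
    ∫ t, g t ∂(expMeasure a) = ∫ t in Ioi 0, a * Real.exp (-(a * t)) * g t := by
  have h1 : expMeasure a = volume.withDensity (exponentialPDF a) := rfl
  rw [h1, integral_withDensity_eq_integral_toReal_smul
    (show Measurable (exponentialPDF a) from (measurable_exponentialPDFReal a).ennreal_ofReal) (ae_of_all _ fun t => ENNReal.ofReal_lt_top),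
    ← integral_Ici_eq_integral_Ioi, ← integral_indicator measurableSet_Ici]
  refine integral_congr_ae (ae_of_all _ fun t => ?_)
  simp only [exponentialPDF_eq, indicator, mem_Ici]
  split_ifs with h
  · rw [ENNReal.toReal_ofReal (mul_nonneg ha.le (Real.exp_pos _).le), smul_eq_mul]
  · simp

theorem expMeasure_real_Iic {a : ℝ} (ha : 0 < a) {t : ℝ} (ht : 0 ≤ t) :
    (expMeasure a).real (Iic t) = 1 - Real.exp (-(a * t)) := by
  have := isProbabilityMeasure_expMeasure ha
  rw [← cdf_eq_real, cdf_expMeasure_eq ha, if_pos ht]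

namespace OpposedDrifts

variable {v Φ : Fin 2 → ℝ → ℝ} {l r : ℝ} {lam : Fin 2 → ℝ}

theorem stoppedFlow_of_notMem {j : Fin 2} {y : ℝ} (hy : y ∉ Ioo l r) (t : ℝ) :
    stoppedFlow Φ l r j y t = y := if_neg hy

theorem stoppedFlow_of_mem {j : Fin 2} {y : ℝ} (hy : y ∈ Ioo l r) (t : ℝ) :
    stoppedFlow Φ l r j y t = travelInverse (Φ j) l r (exitPoint l r j) (Φ j y + t) := if_pos hy

theorem exitPoint_notMem (l r : ℝ) (j : Fin 2) : exitPoint l r j ∉ Ioo l r := by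
  unfold exitPoint
  split_ifs <;> simp

theorem exitPoint_mem_Icc (h : OpposedDrifts v l r) (j : Fin 2) : exitPoint l r j ∈ Icc l r := by
  have := h.lt.le
  unfold exitPoint
  split_ifs <;> simp [this]

theorem measurable_stoppedFlow (h : OpposedDrifts v l r) (hΦ : IsTravelTime v Φ l r) (j : Fin 2) :
    Measurable (fun p : ℝ × ℝ => stoppedFlow Φ l r j p.1 p.2) := by
  classical
  have h1 := measurable_travelInverse (e := exitPoint l r j) (h.injOn hΦ j) (hΦ.continuousOn j)
  have h2 : Measurable ((Ioo l r).piecewise (Φ j) 0) :=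
    (hΦ.continuousOn j).measurable_piecewise continuousOn_const measurableSet_Ioo
  have h3 : (fun p : ℝ × ℝ => stoppedFlow Φ l r j p.1 p.2) = fun p =>
      if p.1 ∈ Ioo l r then
        travelInverse (Φ j) l r (exitPoint l r j) ((Ioo l r).piecewise (Φ j) 0 p.1 + p.2)
      else p.1 := by
    funext p
    by_cases hp : p.1 ∈ Ioo l r
    · rw [stoppedFlow_of_mem hp, if_pos hp, piecewise_eq_of_mem _ _ _ hp]
    · rw [stoppedFlow_of_notMem hp, if_neg hp]
  rw [h3]
  exact Measurable.ite (measurable_fst measurableSet_Ioo)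
    (h1.comp ((h2.comp measurable_fst).add measurable_snd)) measurable_fst

theorem stoppedFlow_cases (h : OpposedDrifts v l r) (hΦ : IsTravelTime v Φ l r) (j : Fin 2)
    {y : ℝ} (hy : y ∈ Ioo l r) (t : ℝ) :
    (stoppedFlow Φ l r j y t ∈ Ioo l r ∧ Φ j (stoppedFlow Φ l r j y t) = Φ j y + t) ∨
      stoppedFlow Φ l r j y t = exitPoint l r j := by
  rw [stoppedFlow_of_mem hy]
  by_cases hz : ∃ z ∈ Ioo l r, Φ j z = Φ j y + t
  · obtain ⟨z, hz, he⟩ := hz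
    left
    rw [← he, travelInverse_apply (h.injOn hΦ j) hz]
    exact ⟨hz, rfl⟩
  · right
    push Not at hz
    exact travelInverse_of_forall_ne hz

theorem stoppedFlow_mem_Icc (h : OpposedDrifts v l r) (hΦ : IsTravelTime v Φ l r) (j : Fin 2)
    {y : ℝ} (hy : y ∈ Icc l r) (t : ℝ) : stoppedFlow Φ l r j y t ∈ Icc l r := by
  by_cases hy' : y ∈ Ioo l r
  · rcases h.stoppedFlow_cases hΦ j hy' t with h1 | h1
    · exact Ioo_subset_Icc_self h1.1
    · rw [h1]; exact h.exitPoint_mem_Icc j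
  · rwa [stoppedFlow_of_notMem hy']

/-! ### Invariance of the scale functions over one holding time -/

/-- By the backward system, `-exp (-λ_j (Φ j z - Φ j y)) (u_j(z) - k)` is a primitive of the
integrand. -/
theorem discounted_integral (h : OpposedDrifts v l r) (hΦ : IsTravelTime v Φ l r)
    (hlam : ∀ j, 0 < lam j) (j : Fin 2) (k y : ℝ) {a b ga gb : ℝ} (hab : a < b)
    (hsub : Ioo a b ⊆ Ioo l r) (hv : ∀ z ∈ Icc a b, v j z ≠ 0)
    (hy : ∀ z ∈ Ioo a b, Φ j y ≤ Φ j z)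
    (ha : Tendsto (fun z => -(Real.exp (-(lam j * (Φ j z - Φ j y))) *
      (exitScale v Φ lam l r j z - k))) (𝓝[>] a) (𝓝 ga))
    (hb : Tendsto (fun z => -(Real.exp (-(lam j * (Φ j z - Φ j y))) *
      (exitScale v Φ lam l r j z - k))) (𝓝[<] b) (𝓝 gb)) :
    ∫ z in a..b, (1 / v j z) * (lam j * Real.exp (-(lam j * (Φ j z - Φ j y))) *
      (exitScale v Φ lam l r (1 - j) z - k)) = gb - ga := by
  refine intervalIntegral.integral_eq_sub_of_hasDerivAt_of_tendsto hab (fun z hz => ?_) ?_ ha hb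
  · have h1 := ((((hΦ j z (hsub hz)).sub_const (Φ j y)).const_mul (lam j)).neg.exp.mul
      ((h.hasDerivAt_exitScale hΦ hlam j (hsub hz)).sub_const k)).neg
    refine h1.congr_deriv ?_
    have h2 := h.exitScale_sub hΦ hlam j (hsub hz)
    simp only [Pi.neg_apply]
    generalize (∫ z in l..r, Psi lam Φ z / v j z)⁻¹ = B at *
    linear_combination (Real.exp (-(lam j * (Φ j z - Φ j y))) / v j z) * h2
  · rw [intervalIntegrable_iff_integrableOn_Ioo_of_le hab.le]
    have hc : ContinuousOn (fun z => 1 / v j z * (lam j * (exitScale v Φ lam l r (1 - j) z - k)))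
        (Icc a b) :=
      (continuousOn_const.div (h.continuous j).continuousOn hv).mul
        (continuousOn_const.mul
          ((h.continuous_exitScale hΦ hlam (1 - j)).continuousOn.sub continuousOn_const))
    have hi : IntegrableOn
        (fun z => 1 / v j z * (lam j * (exitScale v Φ lam l r (1 - j) z - k))) (Ioo a b) :=
      (hc.integrableOn_compact isCompact_Icc).mono_set Ioo_subset_Icc_self
    have hm : AEStronglyMeasurable (fun z => Real.exp (-(lam j * (Φ j z - Φ j y))))
        (volume.restrict (Ioo a b)) :=
      (((continuousOn_const.mul (((hΦ.continuousOn j).mono hsub).sub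
        continuousOn_const)).neg).rexp).aestronglyMeasurable measurableSet_Ioo
    refine (hi.mul_bdd (c := 1) hm ?_).congr (ae_of_all _ fun z => ?_)
    · filter_upwards [ae_restrict_mem measurableSet_Ioo] with z hz
      rw [Real.norm_eq_abs, Real.abs_exp, Real.exp_le_one_iff]
      exact neg_nonpos.2 (mul_nonneg (hlam j).le (sub_nonneg.2 (hy z hz)))
    · simp only
      ring

theorem tendsto_discounted_zero (h : OpposedDrifts v l r) (hΦ : IsTravelTime v Φ l r)
    (hlam : ∀ j, 0 < lam j) (j : Fin 2) (y : ℝ) {e : ℝ} {F : Filter ℝ} (hF : F ≤ 𝓝 e)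
    (hy : ∀ᶠ z in F, Φ j y ≤ Φ j z) :
    Tendsto (fun z => -(Real.exp (-(lam j * (Φ j z - Φ j y))) *
      (exitScale v Φ lam l r j z - exitScale v Φ lam l r j e))) F (𝓝 0) := by
  have h1 : Tendsto (fun z => exitScale v Φ lam l r j z - exitScale v Φ lam l r j e) F (𝓝 0) := by
    have := (((h.continuous_exitScale hΦ hlam j).tendsto e).mono_left hF).sub_const
      (exitScale v Φ lam l r j e)
    rwa [sub_self] at this
  rw [← neg_zero]
  refine (squeeze_zero_norm' ?_ (tendsto_norm_zero.comp h1)).neg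
  filter_upwards [hy] with z hz
  rw [norm_mul, Real.norm_eq_abs (Real.exp _), Real.abs_exp]
  refine mul_le_of_le_one_left (norm_nonneg _) (Real.exp_le_one_iff.2 ?_)
  exact neg_nonpos.2 (mul_nonneg (hlam j).le (sub_nonneg.2 hz))

theorem exitScale_exitPoint (h : OpposedDrifts v l r) (hΦ : IsTravelTime v Φ l r)
    (hlam : ∀ j, 0 < lam j) (i j j' : Fin 2) :
    exitScale v Φ lam l r j (exitPoint l r i) = exitScale v Φ lam l r j' (exitPoint l r i) := by
  unfold exitPoint
  split_ifs
  · rw [h.exitScale_right hΦ hlam, h.exitScale_right hΦ hlam]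
  · rw [h.exitScale_left, h.exitScale_left]

/-- The discount factor does not vanish at the exit end, which is reached in finite time.
Subtracting the value of the scale function there removes that boundary term, leaving only the
contribution of `y`. -/
theorem integral_travelTime (h : OpposedDrifts v l r) (hΦ : IsTravelTime v Φ l r)
    (hlam : ∀ j, 0 < lam j) (j : Fin 2) {y : ℝ} (hy : y ∈ Ioo l r) :
    ∫ z in {z ∈ Ioo l r | Φ j y < Φ j z}, |1 / v j z| * (lam j *
      Real.exp (-(lam j * (Φ j z - Φ j y))) *
      (exitScale v Φ lam l r (1 - j) z - exitScale v Φ lam l r j (exitPoint l r j))) =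
    exitScale v Φ lam l r j y - exitScale v Φ lam l r j (exitPoint l r j) := by
  have hcont : Tendsto (fun z => -(Real.exp (-(lam j * (Φ j z - Φ j y))) *
      (exitScale v Φ lam l r j z - exitScale v Φ lam l r j (exitPoint l r j)))) (𝓝 y)
      (𝓝 (-(exitScale v Φ lam l r j y - exitScale v Φ lam l r j (exitPoint l r j)))) := by
    have h1 : ContinuousAt (Φ j) y := (hΦ j y hy).continuousAt
    have h2 := (h.continuous_exitScale hΦ hlam j).continuousAt (x := y)
    have h3 : ContinuousAt (fun z => -(Real.exp (-(lam j * (Φ j z - Φ j y))) *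
      (exitScale v Φ lam l r j z - exitScale v Φ lam l r j (exitPoint l r j)))) y := by fun_prop
    simpa [ContinuousAt] using h3
  obtain rfl | rfl : j = 0 ∨ j = 1 := by omega
  · have hset : {z ∈ Ioo l r | Φ 0 y < Φ 0 z} = Ioo y r := by
      ext z
      constructor
      · rintro ⟨hz, hlt⟩
        exact ⟨((h.strictMonoOn hΦ).lt_iff_lt hy hz).1 hlt, hz.2⟩
      · intro hz
        have hz' : z ∈ Ioo l r := ⟨hy.1.trans hz.1, hz.2⟩
        exact ⟨hz', (h.strictMonoOn hΦ) hy hz' hz.1⟩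
    have hlt : ∀ z ∈ Ioo y r, Φ 0 y < Φ 0 z := fun z hz => (hset.ge hz).2
    have key := h.discounted_integral hΦ hlam 0 (exitScale v Φ lam l r 0 (exitPoint l r 0)) y
      (a := y) (b := r) hy.2 (fun z hz => ⟨hy.1.trans hz.1, hz.2⟩) (fun z hz => by
        rcases hz.2.lt_or_eq with h1 | h1
        · exact h.ne_zero 0 ⟨hy.1.trans_le hz.1, h1⟩
        · rw [h1]; exact h.pos_right.ne')
      (fun z hz => (hlt z hz).le) (hcont.mono_left nhdsWithin_le_nhds)
      (h.tendsto_discounted_zero hΦ hlam 0 y (e := exitPoint l r 0)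
        (by simpa [exitPoint] using nhdsWithin_le_nhds)
        (by filter_upwards [Ioo_mem_nhdsLT hy.2] with z hz using (hlt z hz).le))
    rw [zero_sub, neg_neg, intervalIntegral.integral_of_le hy.2.le,
      integral_Ioc_eq_integral_Ioo] at key
    rw [hset, ← key]
    refine setIntegral_congr_fun measurableSet_Ioo fun z hz => ?_
    rw [abs_of_pos (one_div_pos.2 (h.pos z ⟨hy.1.trans hz.1, hz.2⟩))]
  · have hset : {z ∈ Ioo l r | Φ 1 y < Φ 1 z} = Ioo l y := by
      ext z
      constructor
      · rintro ⟨hz, hlt⟩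
        exact ⟨hz.1, ((h.strictAntiOn hΦ).lt_iff_gt hy hz).1 hlt⟩
      · intro hz
        have hz' : z ∈ Ioo l r := ⟨hz.1, hz.2.trans hy.2⟩
        exact ⟨hz', (h.strictAntiOn hΦ) hz' hy hz.2⟩
    have hlt : ∀ z ∈ Ioo l y, Φ 1 y < Φ 1 z := fun z hz => (hset.ge hz).2
    have key := h.discounted_integral hΦ hlam 1 (exitScale v Φ lam l r 1 (exitPoint l r 1)) y
      (a := l) (b := y) hy.1 (fun z hz => ⟨hz.1, hz.2.trans hy.2⟩) (fun z hz => by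
        rcases hz.1.lt_or_eq with h1 | h1
        · exact h.ne_zero 1 ⟨h1, hz.2.trans_lt hy.2⟩
        · rw [← h1]; exact h.neg_left.ne)
      (fun z hz => (hlt z hz).le)
      (h.tendsto_discounted_zero hΦ hlam 1 y (e := exitPoint l r 1)
        (by simpa [exitPoint] using nhdsWithin_le_nhds)
        (by filter_upwards [Ioo_mem_nhdsGT hy.1] with z hz using (hlt z hz).le))
      (hcont.mono_left nhdsWithin_le_nhds)
    rw [sub_zero, eq_neg_iff_add_eq_zero, add_comm, ← eq_neg_iff_add_eq_zero,
      intervalIntegral.integral_of_le hy.1.le,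
      integral_Ioc_eq_integral_Ioo, ← integral_neg] at key
    rw [hset, key]
    refine setIntegral_congr_fun measurableSet_Ioo fun z hz => ?_
    rw [abs_of_neg (one_div_neg.2 (h.neg z ⟨hz.1, hz.2.trans hy.2⟩)), neg_mul]

/-- The substitution `t = Φ j z - Φ j y` turns the expectation up to the exit time into
`integral_travelTime`; after the exit time the centred integrand is zero. -/
theorem integral_exitScale_stoppedFlow (h : OpposedDrifts v l r) (hΦ : IsTravelTime v Φ l r)
    (hlam : ∀ j, 0 < lam j) (j : Fin 2) {y : ℝ} (hy : y ∈ Icc l r) :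
    ∫ t, exitScale v Φ lam l r (1 - j) (stoppedFlow Φ l r j y t) ∂(expMeasure (lam j)) =
      exitScale v Φ lam l r j y := by
  have := isProbabilityMeasure_expMeasure (hlam j)
  by_cases hy' : y ∈ Ioo l r
  swap
  · simp only [stoppedFlow_of_notMem hy', integral_const, probReal_univ, one_smul]
    rcases hy.1.eq_or_lt with h1 | h1
    · rw [← h1, h.exitScale_left, h.exitScale_left]
    · have h2 : y = r := le_antisymm hy.2 (not_lt.1 fun h3 => hy' ⟨h1, h3⟩)
      rw [h2, h.exitScale_right hΦ hlam, h.exitScale_right hΦ hlam]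
  set k := exitScale v Φ lam l r j (exitPoint l r j) with hk
  have hm : Measurable fun t => exitScale v Φ lam l r (1 - j) (stoppedFlow Φ l r j y t) :=
    (h.continuous_exitScale hΦ hlam _).measurable.comp
      ((h.measurable_stoppedFlow hΦ j).comp measurable_prodMk_left)
  obtain ⟨M, hM⟩ := (isCompact_Icc (a := l) (b := r)).exists_bound_of_continuousOn
    (h.continuous_exitScale hΦ hlam (1 - j)).continuousOn
  have hint : Integrable (fun t => exitScale v Φ lam l r (1 - j) (stoppedFlow Φ l r j y t))
      (expMeasure (lam j)) :=
    Integrable.of_bound hm.aestronglyMeasurable M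
      (ae_of_all _ fun t => hM _ (h.stoppedFlow_mem_Icc hΦ j hy t))
  have key : ∫ t, (exitScale v Φ lam l r (1 - j) (stoppedFlow Φ l r j y t) - k)
      ∂(expMeasure (lam j)) = exitScale v Φ lam l r j y - k := by
    rw [← h.integral_travelTime hΦ hlam j hy', integral_expMeasure (hlam j)]
    set s := {z ∈ Ioo l r | Φ j y < Φ j z} with hs
    have hsm : MeasurableSet s := by
      have : s = Ioo l r ∩ (Φ j) ⁻¹' Ioi (Φ j y) := rfl
      rw [this]
      exact ((hΦ.continuousOn j).isOpen_inter_preimage isOpen_Ioo isOpen_Ioi).measurableSet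
    have himg := integral_image_eq_integral_abs_deriv_smul (s := s)
      (f := fun z => Φ j z - Φ j y) (f' := fun z => 1 / v j z) hsm
      (fun z hz => ((hΦ j z hz.1).sub_const _).hasDerivWithinAt)
      (fun z hz w hw hzw => h.injOn hΦ j hz.1 hw.1 (sub_left_injective hzw))
      (fun t => lam j * Real.exp (-(lam j * t)) *
        (exitScale v Φ lam l r (1 - j) (stoppedFlow Φ l r j y t) - k))
    rw [setIntegral_eq_of_subset_of_forall_sdiff_eq_zero measurableSet_Ioi
      (s := (fun z => Φ j z - Φ j y) '' s), himg]
    · refine setIntegral_congr_fun hsm fun z hz => ?_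
      simp only [smul_eq_mul]
      rw [stoppedFlow_of_mem hy', add_sub_cancel, travelInverse_apply (h.injOn hΦ j) hz.1]
    · rintro _ ⟨z, hz, rfl⟩
      exact sub_pos.2 hz.2
    · rintro t ⟨ht, hts⟩
      rcases h.stoppedFlow_cases hΦ j hy' t with h1 | h1
      · refine absurd ⟨_, ⟨h1.1, ?_⟩, ?_⟩ hts
        · rw [h1.2]; exact lt_add_of_pos_right _ ht
        · simp only [h1.2, add_sub_cancel_left]
      -- Past the exit time the flow rests at the exit point, where both scale functions agree.
      · rw [h1, h.exitScale_exitPoint hΦ hlam j (1 - j) j, sub_self, mul_zero]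
  rw [integral_sub hint (integrable_const _), integral_const, probReal_univ, one_smul] at key
  linarith

/-! ### Geometric decay of the survival probability -/

/-- The probability that the flow `j`, run for an exponential time, does not leave `(l, r)`. -/
noncomputable def _root_.survival (Φ : Fin 2 → ℝ → ℝ) (lam : Fin 2 → ℝ) (l r : ℝ) (j : Fin 2)
    (y : ℝ) : ℝ :=
  ∫ t, (Ioo l r).indicator 1 (stoppedFlow Φ l r j y t) ∂(expMeasure (lam j))

theorem survival_nonneg (j : Fin 2) (y : ℝ) : 0 ≤ survival Φ lam l r j y :=
  integral_nonneg fun _ => indicator_nonneg (fun _ _ => zero_le_one) _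

theorem survival_of_notMem {j : Fin 2} {y : ℝ} (hy : y ∉ Ioo l r) :
    survival Φ lam l r j y = 0 := by
  simp [survival, stoppedFlow_of_notMem hy, indicator_of_notMem hy]

/-- With `Φ j ≤ C`, survival forces the holding time to be at most `C - Φ j y`. The exponential tail
then gives `κ = exp (-λ_j C)`. -/
theorem exists_survival_le (h : OpposedDrifts v l r) (hΦ : IsTravelTime v Φ l r)
    (hlam : ∀ j, 0 < lam j) (j : Fin 2) :
    ∃ κ > 0, ∀ y ∈ Ioo l r, survival Φ lam l r j y ≤ 1 - κ * Real.exp (lam j * Φ j y) := by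
  have := isProbabilityMeasure_expMeasure (hlam j)
  obtain ⟨C, hC⟩ := h.exists_upper_bound hΦ j
  refine ⟨Real.exp (-(lam j * C)), Real.exp_pos _, fun y hy => ?_⟩
  have h1 : survival Φ lam l r j y ≤
      ∫ t, (Iic (C - Φ j y)).indicator 1 t ∂(expMeasure (lam j)) := by
    refine integral_mono_of_nonneg
      (ae_of_all _ fun _ => indicator_nonneg (fun _ _ => zero_le_one) _)
      ((integrable_const (1 : ℝ)).indicator measurableSet_Iic) (ae_of_all _ fun t => ?_)
    rcases h.stoppedFlow_cases hΦ j hy t with h2 | h2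
    · have ht : t ∈ Iic (C - Φ j y) := by
        have := hC _ h2.1
        rw [h2.2] at this
        exact le_sub_iff_add_le'.2 this
      simp [indicator_of_mem h2.1, indicator_of_mem ht]
    · simp only [h2, indicator_of_notMem (exitPoint_notMem l r j)]
      exact indicator_nonneg (fun _ _ => zero_le_one) _
  rw [integral_indicator_one measurableSet_Iic,
    expMeasure_real_Iic (hlam j) (sub_nonneg.2 (hC y hy))] at h1
  refine h1.trans_eq ?_
  rw [← Real.exp_add]
  congr 2
  ring

theorem survival_le_one (h : OpposedDrifts v l r) (hΦ : IsTravelTime v Φ l r)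
    (hlam : ∀ j, 0 < lam j) (j : Fin 2) (y : ℝ) : survival Φ lam l r j y ≤ 1 := by
  by_cases hy : y ∈ Ioo l r
  · obtain ⟨κ, hκ, H⟩ := h.exists_survival_le hΦ hlam j
    have := mul_pos hκ (Real.exp_pos (lam j * Φ j y))
    linarith [H y hy]
  · rw [survival_of_notMem hy]; exact zero_le_one

/-- `Φ 0` increases and `Φ 1` decreases, so at every point one of them is at least its value at a
fixed `m`: no position is far from exit for both drifts. -/
theorem exists_exp_add_ge (h : OpposedDrifts v l r) (hΦ : IsTravelTime v Φ l r)
    (hlam : ∀ j, 0 < lam j) :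
    ∃ c > 0, ∀ j, ∀ y ∈ Ioo l r,
      c ≤ Real.exp (lam j * Φ j y) + Real.exp (lam (1 - j) * Φ (1 - j) y) := by
  obtain ⟨m, hm⟩ := exists_between h.lt
  refine ⟨min (Real.exp (lam 0 * Φ 0 m)) (Real.exp (lam 1 * Φ 1 m)), by positivity, ?_⟩
  have main : ∀ y ∈ Ioo l r, min (Real.exp (lam 0 * Φ 0 m)) (Real.exp (lam 1 * Φ 1 m)) ≤
      Real.exp (lam 0 * Φ 0 y) + Real.exp (lam 1 * Φ 1 y) := by
    intro y hy
    rcases le_total m y with hmy | hmy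
    · have h1 := Real.exp_le_exp.2 (mul_le_mul_of_nonneg_left
        ((h.strictMonoOn hΦ).monotoneOn hm hy hmy) (hlam 0).le)
      exact (min_le_left _ _).trans (h1.trans (le_add_of_nonneg_right (Real.exp_pos _).le))
    · have h1 := Real.exp_le_exp.2 (mul_le_mul_of_nonneg_left
        ((h.strictAntiOn hΦ).antitoneOn hy hm hmy) (hlam 1).le)
      exact (min_le_right _ _).trans (h1.trans (le_add_of_nonneg_left (Real.exp_pos _).le))
  intro j y hy
  fin_cases j
  · simpa using main y hy
  · simpa [add_comm] using main y hy

/-- One step gives no uniform bound, since the flow is slow near the end it leaves. If `exp (λ_j Φ j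
y) ≥ η`, the first step already exits with probability at least `κ η`. Otherwise a first holding
time at most 1 leaves this exponential below `c / 2`; the other one is then at least `c / 2`, and
the second step is likely enough to exit. -/
theorem exists_survival_two_steps_le_aux (h : OpposedDrifts v l r) (hΦ : IsTravelTime v Φ l r)
    (hlam : ∀ j, 0 < lam j) (j : Fin 2) :
    ∃ ε > 0, ∀ y ∈ Ioo l r,
      ∫ t, survival Φ lam l r (1 - j) (stoppedFlow Φ l r j y t) ∂(expMeasure (lam j)) ≤ 1 - ε := by
  have := isProbabilityMeasure_expMeasure (hlam j)
  obtain ⟨κ, hκ, H⟩ := h.exists_survival_le hΦ hlam j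
  obtain ⟨κ', hκ', H'⟩ := h.exists_survival_le hΦ hlam (1 - j)
  obtain ⟨c, hc, Hc⟩ := h.exists_exp_add_ge hΦ hlam
  -- A holding time at most 1 multiplies the exponential by at most `exp (λ_j)`, which takes `η` to
  -- `c / 2`.
  set η := Real.exp (-lam j) * (c / 2) with hη
  have hη0 : 0 < η := by positivity
  -- The cap at 1 keeps `1 - δ` nonnegative, as needed when the first step has already left and
  -- survival is 0.
  set δ := min (κ' * (c / 2)) 1 with hδ
  have hδ0 : 0 < δ := by positivity
  have hp : 0 < 1 - Real.exp (-(lam j * 1)) := by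
    rw [sub_pos, Real.exp_lt_one_iff, mul_one]
    exact neg_lt_zero.2 (hlam j)
  refine ⟨min (κ * η) (δ * (1 - Real.exp (-(lam j * 1)))), by positivity, fun y hy => ?_⟩
  rcases le_or_gt η (Real.exp (lam j * Φ j y)) with h1 | h1
  · have h2 : ∫ t, survival Φ lam l r (1 - j) (stoppedFlow Φ l r j y t) ∂(expMeasure (lam j)) ≤
        survival Φ lam l r j y := by
      refine integral_mono_of_nonneg (ae_of_all _ fun t => survival_nonneg _ _)
        ?_ (ae_of_all _ fun t => ?_)
      · refine Integrable.of_bound (C := 1) ?_ (ae_of_all _ fun t => ?_)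
        · exact (((measurable_const (a := (1 : ℝ))).indicator measurableSet_Ioo).comp
            ((h.measurable_stoppedFlow hΦ j).comp measurable_prodMk_left)).aestronglyMeasurable
        · exact (norm_indicator_le_norm_self _ _).trans (by simp)
      · by_cases hF : stoppedFlow Φ l r j y t ∈ Ioo l r
        · simpa [indicator_of_mem hF] using h.survival_le_one hΦ hlam _ _
        · simp [survival_of_notMem hF, indicator_of_notMem hF]
    have h3 := mul_le_mul_of_nonneg_left h1 hκ.le
    linarith [H y hy, min_le_left (κ * η) (δ * (1 - Real.exp (-(lam j * 1))))]
  · have h2 : ∫ t, survival Φ lam l r (1 - j) (stoppedFlow Φ l r j y t) ∂(expMeasure (lam j)) ≤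
        ∫ t, (1 - (Iic 1).indicator (fun _ => δ) t) ∂(expMeasure (lam j)) := by
      refine integral_mono_of_nonneg (ae_of_all _ fun t => survival_nonneg _ _)
        ((integrable_const _).sub ((integrable_const _).indicator measurableSet_Iic))
        (ae_of_all _ fun t => ?_)
      by_cases ht : t ∈ Iic 1
      swap
      · simpa [indicator_of_notMem ht] using h.survival_le_one hΦ hlam _ _
      simp only [indicator_of_mem ht]
      rcases h.stoppedFlow_cases hΦ j hy t with h3 | h3
      · have h4 : Real.exp (lam j * Φ j (stoppedFlow Φ l r j y t)) ≤ c / 2 := by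
          rw [h3.2, mul_add, Real.exp_add]
          have h5 : Real.exp (lam j * t) ≤ Real.exp (lam j) :=
            Real.exp_le_exp.2 (mul_le_of_le_one_right (hlam j).le ht)
          calc _ ≤ η * Real.exp (lam j) := mul_le_mul h1.le h5 (Real.exp_pos _).le hη0.le
            _ = c / 2 := by
              rw [hη, mul_right_comm, ← Real.exp_add, neg_add_cancel, Real.exp_zero, one_mul]
        have h5 := Hc j _ h3.1
        have h6 := H' _ h3.1
        have h7 := mul_le_mul_of_nonneg_left (show c / 2 ≤ Real.exp (lam (1 - j) * Φ (1 - j) (stoppedFlow Φ l r j y t)) by linarith) hκ'.le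
        linarith [min_le_left (κ' * (c / 2)) 1]
      · rw [h3, survival_of_notMem (exitPoint_notMem l r j)]
        linarith [min_le_right (κ' * (c / 2)) 1]
    rw [integral_sub (integrable_const _) ((integrable_const _).indicator measurableSet_Iic),
      integral_const, probReal_univ, one_smul, integral_indicator_const _ measurableSet_Iic,
      expMeasure_real_Iic (hlam j) zero_le_one, smul_eq_mul, mul_comm] at h2
    linarith [min_le_right (κ * η) (δ * (1 - Real.exp (-(lam j * 1))))]

theorem exists_survival_two_steps_le (h : OpposedDrifts v l r) (hΦ : IsTravelTime v Φ l r)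
    (hlam : ∀ j, 0 < lam j) :
    ∃ ε > 0, ∀ j y,
      ∫ t, survival Φ lam l r (1 - j) (stoppedFlow Φ l r j y t) ∂(expMeasure (lam j)) ≤
        (1 - ε) * (Ioo l r).indicator 1 y := by
  choose ε hε H using h.exists_survival_two_steps_le_aux hΦ hlam
  refine ⟨min (ε 0) (ε 1), lt_min (hε 0) (hε 1), fun j y => ?_⟩
  by_cases hy : y ∈ Ioo l r
  · have h1 : min (ε 0) (ε 1) ≤ ε j := by
      fin_cases j
      · exact min_le_left _ _
      · exact min_le_right _ _
    simp only [indicator_of_mem hy, Pi.one_apply, mul_one]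
    linarith [H j y hy]
  · simp [stoppedFlow_of_notMem hy, survival_of_notMem hy, indicator_of_notMem hy]

end OpposedDrifts

/-! ### The stopped chain and its absorption probability -/

/-- The positions at the switching times of the alternating motion started from `x` in the
state `i`, with holding times `σ`, stopped on leaving `(l, r)`. -/
noncomputable def stoppedChain (Φ : Fin 2 → ℝ → ℝ) (l r : ℝ) (i : Fin 2) (x : ℝ) (σ : ℕ → ℝ) :
    ℕ → ℝ
  | 0 => x
  | n + 1 => stoppedFlow Φ l r (alternate i n) (stoppedChain Φ l r i x σ n) (σ n)

theorem alternate_zero (i : Fin 2) : alternate i 0 = i := by simp [alternate]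

theorem alternate_succ (i : Fin 2) (n : ℕ) : alternate i (n + 1) = 1 - alternate i n := by
  unfold alternate
  by_cases h : Even n
  · simp [h, Nat.even_add_one]
  · simp [h, Nat.even_add_one]

namespace OpposedDrifts

variable {v Φ : Fin 2 → ℝ → ℝ} {l r : ℝ} {lam : Fin 2 → ℝ} {i : Fin 2} {x : ℝ}

theorem stoppedChain_mem_Icc (h : OpposedDrifts v l r) (hΦ : IsTravelTime v Φ l r)
    (hx : x ∈ Icc l r) (σ : ℕ → ℝ) (n : ℕ) : stoppedChain Φ l r i x σ n ∈ Icc l r := by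
  induction n with
  | zero => exact hx
  | succ n ih => exact h.stoppedFlow_mem_Icc hΦ _ ih _

theorem stoppedChain_eq_of_notMem {σ : ℕ → ℝ} {n m : ℕ} (hnm : n ≤ m)
    (hn : stoppedChain Φ l r i x σ n ∉ Ioo l r) :
    stoppedChain Φ l r i x σ m = stoppedChain Φ l r i x σ n := by
  induction m, hnm using Nat.le_induction with
  | base => rfl
  | succ m _ ih => rw [stoppedChain, ih, stoppedFlow_of_notMem hn]

/-- The chain at step `n` uses only the holding times before `n`, hence is independent of `σ n`. -/
theorem measurable_stoppedChain_iSup {Ω : Type*} (h : OpposedDrifts v l r) (hΦ : IsTravelTime v Φ l r)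
    (σ : ℕ → Ω → ℝ) (n : ℕ) :
    Measurable[⨆ k ∈ Iio n, MeasurableSpace.comap (σ k) inferInstance]
      (fun ω => stoppedChain Φ l r i x (fun k => σ k ω) n) := by
  induction n with
  | zero => exact measurable_const
  | succ n ih =>
    have h1 : Measurable[⨆ k ∈ Iio (n + 1), MeasurableSpace.comap (σ k) inferInstance]
        (fun ω => stoppedChain Φ l r i x (fun k => σ k ω) n) :=
      ih.mono (biSup_mono fun k (hk : k < n) => hk.trans n.lt_succ_self) le_rfl
    have h2 : Measurable[⨆ k ∈ Iio (n + 1), MeasurableSpace.comap (σ k) inferInstance] (σ n) :=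
      (comap_measurable (σ n)).mono
        (le_biSup (fun k => MeasurableSpace.comap (σ k) inferInstance) (mem_Iio.2 n.lt_succ_self))
        le_rfl
    exact (h.measurable_stoppedFlow hΦ (alternate i n)).comp (h1.prodMk h2)

variable {Ω : Type*} [MeasurableSpace Ω] {Q : Measure Ω} {σ : ℕ → Ω → ℝ}

theorem measurable_stoppedChain (h : OpposedDrifts v l r) (hΦ : IsTravelTime v Φ l r)
    (hσ : ∀ n, Measurable (σ n)) (n : ℕ) :
    Measurable (fun ω => stoppedChain Φ l r i x (fun k => σ k ω) n) :=
  (h.measurable_stoppedChain_iSup hΦ σ n).mono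
    (iSup₂_le fun k _ => (hσ k).comap_le) le_rfl

theorem indepFun_stoppedChain (h : OpposedDrifts v l r) (hΦ : IsTravelTime v Φ l r)
    (hσ : ∀ n, Measurable (σ n)) (hind : iIndepFun σ Q) (n : ℕ) :
    IndepFun (fun ω => stoppedChain Φ l r i x (fun k => σ k ω) n) (σ n) Q := by
  have h1 : Indep (⨆ k ∈ Iio n, MeasurableSpace.comap (σ k) inferInstance)
      (⨆ k ∈ ({n} : Set ℕ), MeasurableSpace.comap (σ k) inferInstance) Q :=
    indep_iSup_of_disjoint (fun k => (hσ k).comap_le) hind (by simp)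
  rw [iSup_singleton] at h1
  exact indep_of_indep_of_le_left h1 (h.measurable_stoppedChain_iSup hΦ σ n).comap_le

theorem integral_stoppedChain_succ [IsProbabilityMeasure Q] (h : OpposedDrifts v l r)
    (hΦ : IsTravelTime v Φ l r) (hlam : ∀ j, 0 < lam j) (hx : x ∈ Icc l r)
    (hσ : ∀ n, Measurable (σ n)) (hind : iIndepFun σ Q)
    (hlaw : ∀ n, Q.map (σ n) = expMeasure (lam (alternate i n)))
    {f : ℝ → ℝ} (hf : Measurable f) {M : ℝ} (hM : ∀ z ∈ Icc l r, |f z| ≤ M) (n : ℕ) :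
    ∫ ω, f (stoppedChain Φ l r i x (fun k => σ k ω) (n + 1)) ∂Q =
      ∫ ω, ∫ t, f (stoppedFlow Φ l r (alternate i n)
        (stoppedChain Φ l r i x (fun k => σ k ω) n) t) ∂(expMeasure (lam (alternate i n))) ∂Q := by
  have := isProbabilityMeasure_expMeasure (hlam (alternate i n))
  have hY := h.measurable_stoppedChain (i := i) (x := x) hΦ hσ n
  have hg : Measurable fun p : ℝ × ℝ => f (stoppedFlow Φ l r (alternate i n) p.1 p.2) :=
    hf.comp (h.measurable_stoppedFlow hΦ _)
  have hpair := hY.prodMk (hσ n)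
  have hmap := (indepFun_iff_map_prod_eq_prod_map_map hY.aemeasurable (hσ n).aemeasurable).1
    (h.indepFun_stoppedChain (i := i) (x := x) hΦ hσ hind n)
  have hint : Integrable (fun p : ℝ × ℝ => f (stoppedFlow Φ l r (alternate i n) p.1 p.2))
      (Q.map fun ω => (stoppedChain Φ l r i x (fun k => σ k ω) n, σ n ω)) := by
    rw [integrable_map_measure hg.aestronglyMeasurable hpair.aemeasurable]
    exact Integrable.of_bound (hg.comp hpair).aestronglyMeasurable M (ae_of_all _ fun ω =>
      hM _ (h.stoppedFlow_mem_Icc hΦ _ (h.stoppedChain_mem_Icc hΦ hx _ _) _))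
  have h1 : ∫ ω, f (stoppedChain Φ l r i x (fun k => σ k ω) (n + 1)) ∂Q =
      ∫ p : ℝ × ℝ, f (stoppedFlow Φ l r (alternate i n) p.1 p.2)
        ∂(Q.map fun ω => (stoppedChain Φ l r i x (fun k => σ k ω) n, σ n ω)) :=
    (integral_map hpair.aemeasurable hg.aestronglyMeasurable).symm
  rw [hmap, hlaw n] at h1 hint
  have : IsProbabilityMeasure (Q.map fun ω => stoppedChain Φ l r i x (fun k => σ k ω) n) :=
    Measure.isProbabilityMeasure_map hY.aemeasurable
  rw [h1, integral_prod _ hint, integral_map hY.aemeasurable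
    hg.stronglyMeasurable.integral_prod_right'.aestronglyMeasurable]

theorem measurable_survival (h : OpposedDrifts v l r) (hΦ : IsTravelTime v Φ l r)
    (hlam : ∀ j, 0 < lam j) (j : Fin 2) : Measurable (survival Φ lam l r j) := by
  have := isProbabilityMeasure_expMeasure (hlam j)
  have hg : Measurable fun p : ℝ × ℝ =>
      (Ioo l r).indicator (1 : ℝ → ℝ) (stoppedFlow Φ l r j p.1 p.2) :=
    ((measurable_const (a := (1 : ℝ))).indicator measurableSet_Ioo).comp
      (h.measurable_stoppedFlow hΦ j)
  exact hg.stronglyMeasurable.integral_prod_right'.measurable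

theorem integral_exitScale_stoppedChain [IsProbabilityMeasure Q] (h : OpposedDrifts v l r)
    (hΦ : IsTravelTime v Φ l r) (hlam : ∀ j, 0 < lam j) (hx : x ∈ Icc l r)
    (hσ : ∀ n, Measurable (σ n)) (hind : iIndepFun σ Q)
    (hlaw : ∀ n, Q.map (σ n) = expMeasure (lam (alternate i n))) (n : ℕ) :
    ∫ ω, exitScale v Φ lam l r (alternate i n) (stoppedChain Φ l r i x (fun k => σ k ω) n) ∂Q =
      exitScale v Φ lam l r i x := by
  induction n with
  | zero => simp [alternate_zero, stoppedChain]
  | succ n ih =>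
    obtain ⟨M, hM⟩ := (isCompact_Icc (a := l) (b := r)).exists_bound_of_continuousOn
      (h.continuous_exitScale hΦ hlam (alternate i (n + 1))).continuousOn
    rw [h.integral_stoppedChain_succ hΦ hlam hx hσ hind hlaw
      (h.continuous_exitScale hΦ hlam _).measurable hM n, ← ih]
    refine integral_congr_ae (ae_of_all _ fun ω => ?_)
    simp only [alternate_succ]
    exact h.integral_exitScale_stoppedFlow hΦ hlam _ (h.stoppedChain_mem_Icc hΦ hx _ _)

/-- Two applications of the one-step formula produce the two-step survival bound. Its indicator
factor lets the bound be iterated. -/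
theorem integral_indicator_stoppedChain_le [IsProbabilityMeasure Q] (h : OpposedDrifts v l r)
    (hΦ : IsTravelTime v Φ l r) (hlam : ∀ j, 0 < lam j) (hx : x ∈ Icc l r)
    (hσ : ∀ n, Measurable (σ n)) (hind : iIndepFun σ Q)
    (hlaw : ∀ n, Q.map (σ n) = expMeasure (lam (alternate i n))) :
    ∃ ρ, 0 ≤ ρ ∧ ρ < 1 ∧ ∀ n,
      ∫ ω, (Ioo l r).indicator (1 : ℝ → ℝ) (stoppedChain Φ l r i x (fun k => σ k ω) (2 * n)) ∂Q ≤
        ρ ^ n := by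
  have hI : Measurable ((Ioo l r).indicator (1 : ℝ → ℝ)) :=
    (measurable_const (a := (1 : ℝ))).indicator measurableSet_Ioo
  have hI0 : ∀ z, 0 ≤ (Ioo l r).indicator (1 : ℝ → ℝ) z :=
    fun z => indicator_nonneg (fun _ _ => zero_le_one) z
  have hI1 : ∀ z, |(Ioo l r).indicator (1 : ℝ → ℝ) z| ≤ 1 := fun z => by
    rw [← Real.norm_eq_abs]
    exact (norm_indicator_le_norm_self _ _).trans (by simp)
  obtain ⟨ε, hε, H⟩ := h.exists_survival_two_steps_le hΦ hlam
  refine ⟨max (1 - ε) 0, le_max_right _ _, max_lt (by linarith) zero_lt_one, fun n => ?_⟩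
  induction n with
  | zero =>
    rw [pow_zero]
    refine (integral_mono_of_nonneg (ae_of_all _ fun ω => hI0 _) (integrable_const (1 : ℝ))
      (ae_of_all _ fun ω => (le_abs_self _).trans (hI1 _))).trans_eq (by simp)
  | succ n ih =>
    rw [mul_add, mul_one, show 2 * n + 2 = (2 * n + 1) + 1 by ring,
      h.integral_stoppedChain_succ hΦ hlam hx hσ hind hlaw hI (fun z _ => hI1 z)]
    change ∫ ω, survival Φ lam l r _ _ ∂Q ≤ _
    rw [h.integral_stoppedChain_succ hΦ hlam hx hσ hind hlaw (h.measurable_survival hΦ hlam _)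
      (M := 1) (fun z _ => by
        rw [abs_of_nonneg (survival_nonneg _ _)]; exact h.survival_le_one hΦ hlam _ _)]
    simp only [alternate_succ]
    have hint : Integrable (fun ω => max (1 - ε) 0 * (Ioo l r).indicator (1 : ℝ → ℝ)
        (stoppedChain Φ l r i x (fun k => σ k ω) (2 * n))) Q :=
      (Integrable.of_bound (hI.comp (h.measurable_stoppedChain hΦ hσ _)).aestronglyMeasurable 1
        (ae_of_all _ fun ω => hI1 _)).const_mul _
    refine (integral_mono_of_nonneg
      (ae_of_all _ fun ω => integral_nonneg fun t => survival_nonneg _ _) hint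
      (ae_of_all _ fun ω => (H _ _).trans
        (mul_le_mul_of_nonneg_right (le_max_left _ _) (hI0 _)))).trans ?_
    rw [integral_const_mul, pow_succ']
    exact mul_le_mul_of_nonneg_left ih (le_max_right _ _)

theorem ae_exists_stoppedChain_notMem [IsProbabilityMeasure Q] (h : OpposedDrifts v l r)
    (hΦ : IsTravelTime v Φ l r) (hlam : ∀ j, 0 < lam j) (hx : x ∈ Icc l r)
    (hσ : ∀ n, Measurable (σ n)) (hind : iIndepFun σ Q)
    (hlaw : ∀ n, Q.map (σ n) = expMeasure (lam (alternate i n))) :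
    ∀ᵐ ω ∂Q, ∃ n, stoppedChain Φ l r i x (fun k => σ k ω) n ∉ Ioo l r := by
  obtain ⟨ρ, h0, h1, H⟩ := h.integral_indicator_stoppedChain_le hΦ hlam hx hσ hind hlaw
  have hm := fun n => h.measurable_stoppedChain (i := i) (x := x) hΦ hσ n
  have hle : ∀ n, Q.real {ω | ∀ n, stoppedChain Φ l r i x (fun k => σ k ω) n ∈ Ioo l r} ≤
      ρ ^ n := by
    intro n
    refine le_trans ?_ (H n)
    have h2 : (fun ω => (Ioo l r).indicator (1 : ℝ → ℝ)
        (stoppedChain Φ l r i x (fun k => σ k ω) (2 * n))) =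
        ((fun ω => stoppedChain Φ l r i x (fun k => σ k ω) (2 * n)) ⁻¹' Ioo l r).indicator 1 := by
      funext ω
      simp [indicator]
    rw [h2, integral_indicator_one (hm _ measurableSet_Ioo)]
    exact measureReal_mono fun ω hω => hω _
  have h3 := ge_of_tendsto' (tendsto_pow_atTop_nhds_zero_of_lt_one h0 h1) hle
  have h4 : Q {ω | ∀ n, stoppedChain Φ l r i x (fun k => σ k ω) n ∈ Ioo l r} = 0 :=
    (measureReal_eq_zero_iff).1 (le_antisymm h3 measureReal_nonneg)
  rw [ae_iff]
  simpa using h4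

/-- Optional stopping: the mean of the scale function along the chain is constant, while almost
surely its value is eventually 1 or 0 according to the end at which the chain is absorbed. -/
theorem measureReal_exists_stoppedChain_eq [IsProbabilityMeasure Q] (h : OpposedDrifts v l r)
    (hΦ : IsTravelTime v Φ l r) (hlam : ∀ j, 0 < lam j) (hx : x ∈ Icc l r)
    (hσ : ∀ n, Measurable (σ n)) (hind : iIndepFun σ Q)
    (hlaw : ∀ n, Q.map (σ n) = expMeasure (lam (alternate i n))) :
    Q.real {ω | ∃ n, stoppedChain Φ l r i x (fun k => σ k ω) n = r} =
      exitScale v Φ lam l r i x := by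
  have hm := fun n => h.measurable_stoppedChain (i := i) (x := x) hΦ hσ n
  set A := {ω | ∃ n, stoppedChain Φ l r i x (fun k => σ k ω) n = r} with hA
  have hAm : MeasurableSet A := by
    have : A = ⋃ n, (fun ω => stoppedChain Φ l r i x (fun k => σ k ω) n) ⁻¹' {r} := by
      ext ω; simp [hA]
    rw [this]
    exact MeasurableSet.iUnion fun n => hm n (measurableSet_singleton r)
  choose M hM using fun j => (isCompact_Icc (a := l) (b := r)).exists_bound_of_continuousOn
    (h.continuous_exitScale hΦ hlam j).continuousOn
  have hbound : ∀ j, M j ≤ max (M 0) (M 1) := by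
    intro j
    obtain rfl | rfl : j = 0 ∨ j = 1 := by omega
    · exact le_max_left _ _
    · exact le_max_right _ _
  have hlim : Tendsto (fun n => ∫ ω, exitScale v Φ lam l r (alternate i n)
      (stoppedChain Φ l r i x (fun k => σ k ω) n) ∂Q) atTop
      (𝓝 (∫ ω, A.indicator (1 : Ω → ℝ) ω ∂Q)) := by
    refine tendsto_integral_of_dominated_convergence (fun _ => max (M 0) (M 1))
      (fun n => ((h.continuous_exitScale hΦ hlam _).measurable.comp (hm n)).aestronglyMeasurable)
      (integrable_const _)
      (fun n => ae_of_all _ fun ω => (hM _ _ (h.stoppedChain_mem_Icc hΦ hx _ _)).trans (hbound _))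
      ?_
    filter_upwards [h.ae_exists_stoppedChain_notMem hΦ hlam hx hσ hind hlaw] with ω hω
    obtain ⟨N, hN⟩ := hω
    refine tendsto_const_nhds.congr' ?_
    filter_upwards [eventually_ge_atTop N] with n hn
    rw [stoppedChain_eq_of_notMem hn hN]
    have hI := h.stoppedChain_mem_Icc (i := i) hΦ hx (fun k => σ k ω) N
    by_cases hr : stoppedChain Φ l r i x (fun k => σ k ω) N = r
    · rw [hr, h.exitScale_right hΦ hlam, indicator_of_mem (show ω ∈ A from ⟨N, hr⟩),
        Pi.one_apply]
    · have hl : stoppedChain Φ l r i x (fun k => σ k ω) N = l :=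
        le_antisymm (not_lt.1 fun h1 => hN ⟨h1, hI.2.lt_of_ne hr⟩) hI.1
      rw [hl, h.exitScale_left, indicator_of_notMem]
      rintro ⟨k, hk⟩
      rcases le_total k N with hkN | hkN
      · exact hr ((stoppedChain_eq_of_notMem hkN (by simp [hk])).trans hk)
      · exact hr ((stoppedChain_eq_of_notMem hkN hN).symm.trans hk)
  simp only [h.integral_exitScale_stoppedChain hΦ hlam hx hσ hind hlaw] at hlim
  rw [integral_indicator_one hAm] at hlim
  exact tendsto_nhds_unique hlim tendsto_const_nhds |>.symm ▸ rfl

end OpposedDrifts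

/-! ### From the chain to the continuous path -/

theorem exists_first_exit {f : ℝ → ℝ} (hf : Continuous f) {l r p q : ℝ} (hp : f p ∈ Ioo l r)
    (hex : ∃ t ∈ Icc p q, f t ∉ Ioo l r) :
    ∃ τ ∈ Ioc p q, (f τ = l ∨ f τ = r) ∧ ∀ t ∈ Ico p τ, f t ∈ Ioo l r := by
  have hcomp : IsCompact (Icc p q ∩ f ⁻¹' (Ioo l r)ᶜ) :=
    isCompact_Icc.inter_right (isOpen_Ioo.isClosed_compl.preimage hf)
  obtain ⟨t, ht, hft⟩ := hex
  obtain ⟨τ, ⟨hτ, hfτ⟩, hleast⟩ := hcomp.exists_isLeast ⟨t, ht, hft⟩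
  have hpτ : p < τ := hτ.1.lt_of_ne fun h => hfτ (h ▸ hp)
  have hbefore : ∀ t ∈ Ico p τ, f t ∈ Ioo l r := fun t ht => by
    by_contra hcon
    exact absurd (hleast ⟨⟨ht.1, ht.2.le.trans hτ.2⟩, hcon⟩) (not_le.2 ht.2)
  refine ⟨τ, ⟨hpτ, hτ.2⟩, ?_, hbefore⟩
  have hcl : f τ ∈ Icc l r := by
    have h1 : τ ∈ closure (Ico p τ) := by
      rw [closure_Ico hpτ.ne]; exact right_mem_Icc.2 hpτ.le
    have := hf.continuousWithinAt.mem_closure h1 hbefore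
    exact closure_minimal Ioo_subset_Icc_self isClosed_Icc this
  by_contra hcon
  push Not at hcon
  exact hfτ ⟨hcl.1.lt_of_ne hcon.1.symm, hcl.2.lt_of_ne hcon.2⟩

theorem mem_of_forall_Ico_mem {f : ℝ → ℝ} (hf : Continuous f) {p τ : ℝ} (hpτ : p < τ) {A : Set ℝ}
    (hA : IsClosed A) (h : ∀ t ∈ Ico p τ, f t ∈ A) : f τ ∈ A := by
  have h1 : τ ∈ closure (Ico p τ) := by
    rw [closure_Ico hpτ.ne]; exact right_mem_Icc.2 hpτ.le
  exact hA.closure_subset (hf.continuousWithinAt.mem_closure h1 h)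

namespace OpposedDrifts

variable {v Φ : Fin 2 → ℝ → ℝ} {l r : ℝ}

theorem travelTime_of_hasDerivAt (hΦ : IsTravelTime v Φ l r) {j : Fin 2} {f : ℝ → ℝ}
    (hf : Continuous f) {p t : ℝ} (hpt : p ≤ t)
    (hder : ∀ s ∈ Ioo p t, HasDerivAt f (v j (f s)) s) (hv : ∀ s ∈ Icc p t, v j (f s) ≠ 0)
    (hmem : ∀ s ∈ Icc p t, f s ∈ Ioo l r) : Φ j (f t) = Φ j (f p) + (t - p) := by
  rcases hpt.eq_or_lt with rfl | hlt
  · simp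
  obtain ⟨s, hs, hslope⟩ := exists_hasDerivAt_eq_slope (fun s => Φ j (f s)) (fun _ => 1) hlt
    (fun s hs => ((hΦ j _ (hmem s hs)).continuousAt.comp hf.continuousAt).continuousWithinAt)
    (fun s hs => by
      have := (hΦ j _ (hmem s (Ioo_subset_Icc_self hs))).comp s (hder s hs)
      rwa [one_div_mul_cancel (hv s (Ioo_subset_Icc_self hs))] at this)
  rw [eq_div_iff (sub_pos.2 hlt).ne'] at hslope
  linarith

/-- While the path stays inside, `Φ j` grows along it at unit speed, so it agrees with the flow.
Monotonicity of `Φ j` decides through which end it leaves. -/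
theorem path_step (h : OpposedDrifts v l r) (hΦ : IsTravelTime v Φ l r) (j : Fin 2) {f : ℝ → ℝ}
    (hf : Continuous f) {p q : ℝ} (hpq : p ≤ q)
    (hder : ∀ s ∈ Ioo p q, HasDerivAt f (v j (f s)) s) (hp : f p ∈ Ioo l r) :
    ((∀ t ∈ Icc p q, f t ∈ Ioo l r) ∧ stoppedFlow Φ l r j (f p) (q - p) = f q) ∨
    (stoppedFlow Φ l r j (f p) (q - p) = exitPoint l r j ∧
      ∃ τ ∈ Ioc p q, f τ = exitPoint l r j ∧ ∀ t ∈ Ico p τ, f t ∈ Ioo l r) := by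
  by_cases hall : ∀ t ∈ Icc p q, f t ∈ Ioo l r
  · refine Or.inl ⟨hall, ?_⟩
    rw [stoppedFlow_of_mem hp, ← travelTime_of_hasDerivAt hΦ hf hpq hder
      (fun s hs => h.ne_zero j (hall s hs)) hall,
      travelInverse_apply (h.injOn hΦ j) (hall q (right_mem_Icc.2 hpq))]
  right
  push Not at hall
  obtain ⟨τ, hτ, hend, hbefore⟩ := exists_first_exit hf hp hall
  have htime : ∀ t ∈ Ico p τ, Φ j (f t) = Φ j (f p) + (t - p) := fun t ht => by
    have hm : ∀ s ∈ Icc p t, f s ∈ Ioo l r := fun s hs => hbefore s ⟨hs.1, hs.2.trans_lt ht.2⟩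
    exact travelTime_of_hasDerivAt hΦ hf ht.1
      (fun s hs => hder s ⟨hs.1, (hs.2.trans ht.2).trans_le hτ.2⟩)
      (fun s hs => h.ne_zero j (hm s hs)) hm
  have hexit : f τ = exitPoint l r j := by
    obtain rfl | rfl : j = 0 ∨ j = 1 := by omega
    · have h1 : f τ ∈ Ici (f p) := mem_of_forall_Ico_mem hf hτ.1 isClosed_Ici fun t ht => by
        refine ((h.strictMonoOn hΦ).le_iff_le hp (hbefore t ht)).1 ?_
        rw [htime t ht]; linarith [ht.1]
      rcases hend with h2 | h2
      · exact absurd (h2 ▸ h1 : f p ≤ l) (not_le.2 hp.1)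
      · simp [exitPoint, h2]
    · have h1 : f τ ∈ Iic (f p) := mem_of_forall_Ico_mem hf hτ.1 isClosed_Iic fun t ht => by
        refine ((h.strictAntiOn hΦ).le_iff_ge hp (hbefore t ht)).1 ?_
        rw [htime t ht]; linarith [ht.1]
      rcases hend with h2 | h2
      · simp [exitPoint, h2]
      · exact absurd (h2 ▸ h1 : r ≤ f p) (not_le.2 hp.2)
  refine ⟨?_, τ, hτ, hexit, hbefore⟩
  rw [stoppedFlow_of_mem hp]
  -- If `Φ j y + t` were still attained at an interior `z`, the path would stay on the near side of
  -- `z` up to `τ` and could not be at the endpoint.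
  refine travelInverse_of_forall_ne fun z hz hzt => ?_
  have hle : ∀ t ∈ Ico p τ, Φ j (f t) ≤ Φ j z := fun t ht => by
    rw [htime t ht, hzt]; linarith [ht.2, hτ.2]
  obtain rfl | rfl : j = 0 ∨ j = 1 := by omega
  · have h1 : f τ ∈ Iic z := mem_of_forall_Ico_mem hf hτ.1 isClosed_Iic fun t ht =>
      ((h.strictMonoOn hΦ).le_iff_le (hbefore t ht) hz).1 (hle t ht)
    rw [hexit] at h1
    exact absurd (by simpa [exitPoint] using h1 : r ≤ z) (not_le.2 hz.2)
  · have h1 : f τ ∈ Ici z := mem_of_forall_Ico_mem hf hτ.1 isClosed_Ici fun t ht =>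
      ((h.strictAntiOn hΦ).le_iff_ge (hbefore t ht) hz).1 (hle t ht)
    rw [hexit] at h1
    exact absurd (by simpa [exitPoint] using h1 : z ≤ l) (not_le.2 hz.1)

/-- Gronwall's inequality on a crossing from `l` to `r`: there `f - l` is at most `L` times its own
integral, which forces `f ≤ l`. -/
theorem lt_right_of_le_left (h : OpposedDrifts v l r) {f : ℝ → ℝ} (hf : Continuous f) {p : ℝ}
    (hsub : ∀ s t, p ≤ s → s ≤ t → f t - f s ≤ ∫ u in s..t, v 0 (f u)) (hp : f p ≤ l)
    {q : ℝ} (hpq : p ≤ q) : f q < r := by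
  by_contra! hq
  obtain ⟨L, hL, hbound⟩ := h.linear_bound
  -- The linear bound holds only inside `(l, r)`, and the path may go below `l`. The crossing is
  -- thus isolated between the last time at or below `l` and the first later time at or above `r`.
  obtain ⟨s, ⟨hs, hfs⟩, hgreat⟩ :=
    (isCompact_Icc.inter_right (isClosed_Iic.preimage hf)).exists_isGreatest
      (⟨p, left_mem_Icc.2 hpq, hp⟩ : (Icc p q ∩ f ⁻¹' Iic l).Nonempty)
  obtain ⟨τ, ⟨hτ, hfτ⟩, hleast⟩ :=
    (isCompact_Icc.inter_right (isClosed_Ici.preimage hf)).exists_isLeast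
      (⟨q, right_mem_Icc.2 hs.2, hq⟩ : (Icc s q ∩ f ⁻¹' Ici r).Nonempty)
  have hmem : ∀ t ∈ Ioo s τ, f t ∈ Ioo l r := fun t ht => by
    constructor
    · by_contra! hcon
      exact absurd (hgreat ⟨⟨hs.1.trans ht.1.le, ht.2.le.trans hτ.2⟩, hcon⟩) (not_le.2 ht.1)
    · by_contra! hcon
      exact absurd (hleast ⟨⟨ht.1.le, ht.2.le.trans hτ.2⟩, hcon⟩) (not_le.2 ht.2)
  set g : ℝ → ℝ := fun t => ∫ u in s..t, (f u - l) with hg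
  have hcont : Continuous fun u => f u - l := hf.sub continuous_const
  have hgd : ∀ t, HasDerivAt g (f t - l) t := fun t =>
    intervalIntegral.integral_hasDerivAt_right (hcont.intervalIntegrable _ _)
      (hcont.stronglyMeasurableAtFilter _ _) hcont.continuousAt
  have hle : ∀ t ∈ Icc s τ, f t - l ≤ L * g t := fun t ht => by
    have h1 := hsub s t hs.1 ht.1
    have h2 : ∫ u in s..t, v 0 (f u) ≤ ∫ u in s..t, L * (f u - l) :=
      intervalIntegral.integral_mono_on_of_le_Ioo ht.1
        (((h.continuous 0).comp hf).intervalIntegrable _ _)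
        ((continuous_const.mul hcont).intervalIntegrable _ _)
        fun u hu => (hbound _ (hmem u ⟨hu.1, hu.2.trans_le ht.2⟩)).1
    rw [intervalIntegral.integral_const_mul] at h2
    have h3 : f s ≤ l := hfs
    linarith
  have hed : ∀ t, HasDerivAt (fun t => Real.exp (-(L * t)) * g t)
      (Real.exp (-(L * t)) * ((f t - l) - L * g t)) t := fun t => by
    refine ((((hasDerivAt_id t).const_mul L).neg.exp).mul (hgd t)).congr_deriv ?_
    simp
    ring
  have hanti : AntitoneOn (fun t => Real.exp (-(L * t)) * g t) (Icc s τ) := by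
    refine antitoneOn_of_deriv_nonpos (convex_Icc _ _)
      (fun t _ => (hed t).continuousAt.continuousWithinAt)
      (fun t _ => (hed t).differentiableAt.differentiableWithinAt) fun t ht => ?_
    rw [(hed t).deriv]
    exact mul_nonpos_of_nonneg_of_nonpos (Real.exp_pos _).le
      (sub_nonpos.2 (hle t (interior_subset ht)))
  have h4 := hanti (left_mem_Icc.2 hτ.1) (right_mem_Icc.2 hτ.1) hτ.1
  have h5 : g s = 0 := intervalIntegral.integral_same
  simp only [h5, mul_zero] at h4
  have h6 : g τ ≤ 0 := nonpos_of_mul_nonpos_right h4 (Real.exp_pos _)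
  have h7 := hle τ (right_mem_Icc.2 hτ.1)
  have h8 : r ≤ f τ := hfτ
  have := mul_nonpos_of_nonneg_of_nonpos hL.le h6
  linarith [h.lt]

/-- Along a path that follows the drift of the current state, the stopped chain detects the
hitting of `r`. -/
theorem exists_stoppedChain_eq_iff (h : OpposedDrifts v l r) (hΦ : IsTravelTime v Φ l r)
    {i : Fin 2} {x : ℝ} (hx : x ∈ Ioo l r) {σ : ℕ → ℝ} (hσ : ∀ n, 0 ≤ σ n) {f : ℝ → ℝ}
    (hf : Continuous f) (hf0 : f 0 = x)
    (hder : ∀ n, ∀ t ∈ Ioo (∑ k ∈ Finset.range n, σ k) (∑ k ∈ Finset.range (n + 1), σ k),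
      HasDerivAt f (v (alternate i n) (f t)) t)
    (hsub : ∀ s t, 0 ≤ s → s ≤ t → f t - f s ≤ ∫ u in s..t, v 0 (f u))
    (habs : ∃ n, stoppedChain Φ l r i x σ n ∉ Ioo l r) :
    (∃ n, stoppedChain Φ l r i x σ n = r) ↔ ∃ t, 0 < t ∧ f t = r := by
  have hS : ∀ n, 0 ≤ ∑ k ∈ Finset.range n, σ k := fun n => Finset.sum_nonneg fun k _ => hσ k
  -- In the third alternative the chain is frozen at `l` while the path moves on. The record that
  -- `r` was not hit up to the time `s` at `l` leaves only later times to exclude.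
  have key : ∀ n,
      (stoppedChain Φ l r i x σ n ∈ Ioo l r ∧
        f (∑ k ∈ Finset.range n, σ k) = stoppedChain Φ l r i x σ n ∧
        ∀ t ∈ Icc 0 (∑ k ∈ Finset.range n, σ k), f t ∈ Ioo l r) ∨
      (stoppedChain Φ l r i x σ n = r ∧ ∃ t, 0 < t ∧ f t = r) ∨
      (stoppedChain Φ l r i x σ n = l ∧ ∃ s, 0 ≤ s ∧ f s = l ∧ ∀ t ∈ Icc 0 s, f t ≠ r) := by
    intro n
    induction n with
    | zero =>
      refine Or.inl ⟨hx, by simpa [stoppedChain] using hf0, fun t ht => ?_⟩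
      have : t = 0 := by simpa using ht
      rw [this, hf0]; exact hx
    | succ n ih =>
      rcases ih with ⟨h1, h2, h3⟩ | ⟨h1, h2⟩ | ⟨h1, h2⟩
      · have hstep : ∑ k ∈ Finset.range (n + 1), σ k - ∑ k ∈ Finset.range n, σ k = σ n := by
          rw [Finset.sum_range_succ, add_sub_cancel_left]
        have hle : ∑ k ∈ Finset.range n, σ k ≤ ∑ k ∈ Finset.range (n + 1), σ k := by
          rw [Finset.sum_range_succ]; exact le_add_of_nonneg_right (hσ n)
        have hcase := h.path_step hΦ (alternate i n) hf hle (hder n) (by rw [h2]; exact h1)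
        rw [hstep, h2, ← stoppedChain] at hcase
        rcases hcase with ⟨h4, h5⟩ | ⟨h4, τ, hτ, h5, h6⟩
        · refine Or.inl ⟨?_, h5.symm, fun t ht => ?_⟩
          · rw [h5]; exact h4 _ (right_mem_Icc.2 hle)
          · rcases le_total t (∑ k ∈ Finset.range n, σ k) with h7 | h7
            · exact h3 t ⟨ht.1, h7⟩
            · exact h4 t ⟨h7, ht.2⟩
        · right
          have hτ0 : 0 < τ := (hS n).trans_lt hτ.1
          by_cases hj : alternate i n = 0
          · left
            rw [exitPoint, if_pos hj] at h4 h5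
            exact ⟨h4, τ, hτ0, h5⟩
          · right
            rw [exitPoint, if_neg hj] at h4 h5
            refine ⟨h4, τ, hτ0.le, h5, fun t ht hr => ?_⟩
            rcases ht.2.eq_or_lt with h7 | h7
            · rw [h7, h5] at hr; exact h.lt.ne hr
            · have hmem : f t ∈ Ioo l r := by
                rcases le_total t (∑ k ∈ Finset.range n, σ k) with h8 | h8
                · exact h3 t ⟨ht.1, h8⟩
                · exact h6 t ⟨h8, h7⟩
              exact hmem.2.ne hr
      · refine Or.inr (Or.inl ⟨?_, h2⟩)
        rw [stoppedChain_eq_of_notMem n.le_succ (by simp [h1]), h1]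
      · refine Or.inr (Or.inr ⟨?_, h2⟩)
        rw [stoppedChain_eq_of_notMem n.le_succ (by simp [h1]), h1]
  constructor
  · rintro ⟨n, hn⟩
    rcases key n with ⟨h1, -⟩ | ⟨-, h1⟩ | ⟨h1, -⟩
    · exact absurd hn h1.2.ne
    · exact h1
    · exact absurd (h1.symm.trans hn) h.lt.ne
  · rintro ⟨t, ht, hft⟩
    obtain ⟨n, hn⟩ := habs
    rcases key n with ⟨h1, -⟩ | ⟨h1, -⟩ | ⟨-, s, hs0, hs, hs1⟩
    · exact absurd h1 hn
    · exact ⟨n, h1⟩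
    · rcases le_total t s with hts | hts
      · exact absurd hft (hs1 t ⟨ht.le, hts⟩)
      · exact absurd hft (h.lt_right_of_le_left hf
          (fun a b ha hab => hsub a b (hs0.trans ha) hab) hs.le hts).ne

end OpposedDrifts

/-! ### Regularity of the driving path and of the solution -/

/-- Measurability of `ξ t` in `ω` says nothing about measurability in time. That comes from the
constancy on the holding intervals, which cover the half-line because `S` diverges. -/
theorem intervalIntegrable_of_piecewise_const {w : ℝ → ℝ} {S : ℕ → ℝ} {d : ℕ → ℝ} {M : ℝ}
    (hS0 : S 0 = 0) (hS : Tendsto S atTop atTop)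
    (hw : ∀ n, ∀ t, S n ≤ t → t < S (n + 1) → w t = d n) (hM : ∀ t, |w t| ≤ M) {a b : ℝ}
    (ha : 0 ≤ a) (hb : 0 ≤ b) : IntervalIntegrable w volume a b := by
  have hcover : Ici (0 : ℝ) ⊆ ⋃ n, Ico (S n) (S (n + 1)) := by
    intro t ht
    have hex : ∃ n, t < S n := (hS.eventually_gt_atTop t).exists
    classical
    have hn0 : Nat.find hex ≠ 0 := fun h0 => by
      have := Nat.find_spec hex
      rw [h0, hS0] at this
      exact absurd ht (not_le.2 this)
    obtain ⟨m, hm⟩ := Nat.exists_eq_succ_of_ne_zero hn0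
    refine mem_iUnion.2 ⟨m, ?_, ?_⟩
    · exact not_lt.1 (Nat.find_min hex (by omega))
    · have := Nat.find_spec hex
      rwa [hm] at this
  have hmeas : AEStronglyMeasurable w (volume.restrict (⋃ n, Ico (S n) (S (n + 1)))) := by
    rw [aestronglyMeasurable_iUnion_iff]
    intro n
    refine (aestronglyMeasurable_const (b := d n)).congr ?_
    filter_upwards [ae_restrict_mem measurableSet_Ico] with t ht
    exact (hw n t ht.1 ht.2).symm
  have hsub : uIcc a b ⊆ Ici 0 := fun t ht => (le_min ha hb).trans ht.1
  rw [intervalIntegrable_iff]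
  have : IsFiniteMeasure (volume.restrict (uIoc a b)) := ⟨by
    rw [Measure.restrict_apply_univ]; exact measure_Ioc_lt_top⟩
  exact Integrable.of_bound (hmeas.mono_set ((uIoc_subset_uIcc.trans hsub).trans hcover)) M
    (ae_of_all _ hM)

theorem sub_eq_integral_of_solves {f g w : ℝ → ℝ} {x : ℝ} (hf : Continuous f) (hg : Continuous g)
    (hw : ∀ a b, 0 ≤ a → 0 ≤ b → IntervalIntegrable w volume a b)
    (hsol : ∀ t, 0 ≤ t → f t = x - (∫ s in (0 : ℝ)..t, g (f s)) + ∫ s in (0 : ℝ)..t, w s)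
    {s t : ℝ} (hs : 0 ≤ s) (ht : 0 ≤ t) : f t - f s = ∫ u in s..t, (w u - g (f u)) := by
  have hi : ∀ a b, IntervalIntegrable (fun u => g (f u)) volume a b :=
    fun a b => (hg.comp hf).intervalIntegrable a b
  rw [intervalIntegral.integral_sub (hw s t hs ht) (hi s t), hsol t ht, hsol s hs,
    ← intervalIntegral.integral_interval_sub_left (hw 0 t le_rfl ht) (hw 0 s le_rfl hs),
    ← intervalIntegral.integral_interval_sub_left (hi 0 t) (hi 0 s)]
  ring

theorem hasDerivAt_of_sub_eq_integral {f g w : ℝ → ℝ} {d p q : ℝ} (hf : Continuous f)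
    (hg : Continuous g)
    (hsub : ∀ t ∈ Ioo p q, f t - f p = ∫ u in p..t, (w u - g (f u)))
    (hd : ∀ t, p ≤ t → t < q → w t = d) {t : ℝ} (ht : t ∈ Ioo p q) :
    HasDerivAt f (d - g (f t)) t := by
  have hc : Continuous fun u => d - g (f u) := continuous_const.sub (hg.comp hf)
  have h1 : HasDerivAt (fun t => f p + ∫ u in p..t, (d - g (f u))) (d - g (f t)) t :=
    (intervalIntegral.integral_hasDerivAt_right (hc.intervalIntegrable _ _)
      (hc.stronglyMeasurableAtFilter _ _) hc.continuousAt).const_add _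
  refine h1.congr_of_eventuallyEq ?_
  filter_upwards [Ioo_mem_nhds ht.1 ht.2] with s hs
  rw [← sub_eq_iff_eq_add', hsub s hs]
  refine intervalIntegral.integral_congr fun u hu => ?_
  rw [uIcc_of_le hs.1.le] at hu
  simp only [hd u hu.1 (hu.2.trans_lt hs.2)]

/-! ### Holding times: positivity and absence of explosion -/

section HoldingTimes

variable {Ω : Type*} [MeasurableSpace Ω] {Q : Measure Ω} [IsProbabilityMeasure Q]
  {σ : ℕ → Ω → ℝ} {lam : Fin 2 → ℝ} {i : Fin 2}

theorem ae_forall_holding_pos (hlam : ∀ j, 0 < lam j) (hσ : ∀ n, Measurable (σ n))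
    (hlaw : ∀ n, Q.map (σ n) = expMeasure (lam (alternate i n))) :
    ∀ᵐ ω ∂Q, ∀ n, 0 < σ n ω := by
  rw [ae_all_iff]
  intro n
  have h1 := expMeasure_real_Iic (hlam (alternate i n)) le_rfl
  rw [mul_zero, neg_zero, Real.exp_zero, sub_self, ← hlaw n,
    map_measureReal_apply (hσ n) measurableSet_Iic, measureReal_eq_zero_iff] at h1
  rw [ae_iff]
  simpa [preimage, not_lt] using h1

theorem measure_one_lt_holding (hlam : ∀ j, 0 < lam j) (hσ : ∀ n, Measurable (σ n))
    (hlaw : ∀ n, Q.map (σ n) = expMeasure (lam (alternate i n))) (n : ℕ) :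
    Q (σ n ⁻¹' Ioi 1) = ENNReal.ofReal (Real.exp (-lam (alternate i n))) := by
  have h1 := expMeasure_real_Iic (hlam (alternate i n)) zero_le_one
  rw [← hlaw n, map_measureReal_apply (hσ n) measurableSet_Iic, mul_one] at h1
  have h2 : σ n ⁻¹' Ioi 1 = (σ n ⁻¹' Iic 1)ᶜ := by
    rw [← preimage_compl, compl_Iic]
  have h3 : Q.real (σ n ⁻¹' Ioi 1) = Real.exp (-lam (alternate i n)) := by
    rw [h2, probReal_compl_eq_one_sub (hσ n measurableSet_Iic), h1]
    ring
  rw [← h3, ofReal_measureReal]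

/-- The independent events `σ n > 1` have probabilities bounded below, so by the second
Borel–Cantelli lemma infinitely many occur. -/
theorem ae_tendsto_sum_holding (hlam : ∀ j, 0 < lam j) (hσ : ∀ n, Measurable (σ n))
    (hind : iIndepFun σ Q) (hlaw : ∀ n, Q.map (σ n) = expMeasure (lam (alternate i n))) :
    ∀ᵐ ω ∂Q, Tendsto (fun n => ∑ k ∈ Finset.range n, σ k ω) atTop atTop := by
  have hm : ∀ n, MeasurableSet (σ n ⁻¹' Ioi 1) := fun n => hσ n measurableSet_Ioi
  have hset : iIndepSet (fun n => σ n ⁻¹' Ioi 1) Q := by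
    rw [iIndepSet_iff_meas_biInter hm]
    intro s
    exact hind.measure_inter_preimage_eq_mul s fun _ _ => measurableSet_Ioi
  have hsum : ∑' n, Q (σ n ⁻¹' Ioi 1) = ⊤ := by
    refine top_unique ?_
    rw [← ENNReal.tsum_const_eq_top_of_ne_zero (α := ℕ)
      (c := ENNReal.ofReal (min (Real.exp (-lam 0)) (Real.exp (-lam 1))))
      (ENNReal.ofReal_pos.2 (by positivity)).ne']
    refine ENNReal.tsum_le_tsum fun n => ?_
    rw [measure_one_lt_holding hlam hσ hlaw n]
    refine ENNReal.ofReal_le_ofReal ?_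
    generalize alternate i n = j
    obtain rfl | rfl : j = 0 ∨ j = 1 := by omega
    · exact min_le_left _ _
    · exact min_le_right _ _
  have hlimsup := measure_limsup_eq_one hm hset hsum
  have hae : ∀ᵐ ω ∂Q, ω ∈ limsup (fun n => σ n ⁻¹' Ioi 1) atTop :=
    (prob_compl_eq_zero_iff (MeasurableSet.measurableSet_limsup hm)).2 hlimsup
  filter_upwards [hae, ae_forall_holding_pos hlam hσ hlaw] with ω h1 h2
  rw [mem_limsup_iff_frequently_mem] at h1
  refine (not_summable_iff_tendsto_nat_atTop_of_nonneg fun n => (h2 n).le).1 fun hs => ?_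
  have h3 := hs.tendsto_atTop_zero.eventually_lt_const (zero_lt_one (α := ℝ))
  obtain ⟨n, h4, h5⟩ := (h1.and_eventually h3).exists
  exact absurd h5 (not_lt.2 (le_of_lt h4))

end HoldingTimes

/-! ### The double-well potential and the exit formulas -/

theorem firstPassage_lt_top_iff {Ω : Type*} {X : ℝ → Ω → ℝ} {y : ℝ} {ω : Ω} :
    firstPassage X y ω < ⊤ ↔ ∃ t, 0 < t ∧ X t ω = y := by
  simp [firstPassage, iInf_lt_iff]

/-- By the intermediate value theorem `U' - k` keeps its sign between consecutive critical points,
so one sample point fixes it. -/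
theorem IsCriticalTriple.lt_deriv {U : ℝ → ℝ} {k p q r a b : ℝ} (h : IsCriticalTriple U k p q r)
    (hU : Continuous (deriv U)) (hab : (a = p ∧ b = q) ∨ (a = q ∧ b = r)) {y : ℝ}
    (hy : y ∈ Ioo a b) (hk : k < deriv U y) {z : ℝ} (hz : z ∈ Ioo a b) : k < deriv U z := by
  by_contra! hcon
  obtain ⟨w, hw, hwk⟩ := isPreconnected_Ioo.intermediate_value hz hy hU.continuousOn ⟨hcon, hk.le⟩
  have h1 := h.lt_left
  have h2 := h.lt_right
  rcases (h.critical_iff w).1 hwk with h3 | h3 | h3 <;> rcases hab with ⟨rfl, rfl⟩ | ⟨rfl, rfl⟩ <;>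
    linarith [hw.1, hw.2]

theorem IsCriticalTriple.deriv_lt {U : ℝ → ℝ} {k p q r a b : ℝ} (h : IsCriticalTriple U k p q r)
    (hU : Continuous (deriv U)) (hab : (a = p ∧ b = q) ∨ (a = q ∧ b = r)) {y : ℝ}
    (hy : y ∈ Ioo a b) (hk : deriv U y < k) {z : ℝ} (hz : z ∈ Ioo a b) : deriv U z < k := by
  by_contra! hcon
  obtain ⟨w, hw, hwk⟩ := isPreconnected_Ioo.intermediate_value hy hz hU.continuousOn ⟨hk.le, hcon⟩
  have h1 := h.lt_left
  have h2 := h.lt_right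
  rcases (h.critical_iff w).1 hwk with h3 | h3 | h3 <;> rcases hab with ⟨rfl, rfl⟩ | ⟨rfl, rfl⟩ <;>
    linarith [hw.1, hw.2]

/-- The minimum of `U'` gives `a0 < bp` and `U' < c 0` on `(b0, bp)`; the maximum gives `am < b0`
and `U' > c 1` on `(am, a0)`. Both intervals contain `(b0, a0)`. The linear bounds hold because `U'`
is Lipschitz with `U' b0 = c 0` and `U' a0 = c 1`. -/
theorem IsSmallVelocityRegime.opposedDrifts {U : ℝ → ℝ} {c : Fin 2 → ℝ}
    {V v am a0 ap bm b0 bp : ℝ} (hreg : IsSmallVelocityRegime U c V v am a0 ap bm b0 bp)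
    (hU : ContDiff ℝ 1 (deriv U)) (hlt : b0 < a0) :
    OpposedDrifts (fun j y => c j - deriv U y) b0 a0 := by
  have hcont := hU.continuous
  obtain ⟨y, ⟨hy1, hy2⟩, -, hyV⟩ := hreg.exists_max
  obtain ⟨z, ⟨hz1, hz2⟩, -, hzv⟩ := hreg.exists_min
  have hc := hreg.c_lt
  have ha : deriv U a0 = c 1 := (hreg.critical_one.critical_iff a0).2 (Or.inr (Or.inl rfl))
  have hb : deriv U b0 = c 0 := (hreg.critical_zero.critical_iff b0).2 (Or.inr (Or.inl rfl))
  obtain ⟨L, hL⟩ := (isCompact_Icc (a := b0) (b := a0)).exists_bound_of_continuousOn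
    (hU.continuous_deriv le_rfl).continuousOn
  have hlip : ∀ s ∈ Icc b0 a0, ∀ t ∈ Icc b0 a0, s ≤ t →
      deriv U s - deriv U t ≤ (max L 1) * (t - s) := by
    intro s hs t ht hst
    have h1 := (convex_Icc b0 a0).norm_image_sub_le_of_norm_deriv_le (f := deriv U) (C := max L 1)
      (fun u _ => (hU.differentiable one_ne_zero).differentiableAt)
      (fun u hu => (hL u hu).trans (le_max_left _ _)) ht hs
    rw [Real.norm_eq_abs, Real.norm_eq_abs, abs_sub_comm s t, abs_of_nonneg (sub_nonneg.2 hst)] at h1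
    exact (le_abs_self _).trans h1
  refine ⟨hlt, fun j => continuous_const.sub hcont, fun w hw => ?_, fun w hw => ?_, ?_, ?_,
    max L 1, by positivity, fun w hw => ⟨?_, ?_⟩⟩
  · exact sub_pos.2 (hreg.critical_zero.deriv_lt hcont (Or.inr ⟨rfl, rfl⟩) hz2
      (by rw [hzv]; exact hreg.v_lt.trans hc) ⟨hw.1, hw.2.trans (hz1.1.trans hz2.2)⟩)
  · exact sub_neg.2 (hreg.critical_one.lt_deriv hcont (Or.inl ⟨rfl, rfl⟩) hy1
      (by rw [hyV]; exact hc.trans hreg.lt_V) ⟨(hy1.1.trans hy2.2).trans hw.1, hw.2⟩)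
  · simp only [ha]; exact sub_pos.2 hc
  · simp only [hb]; exact sub_neg.2 hc
  · simp only [← hb]
    exact hlip b0 (left_mem_Icc.2 hlt.le) w (Ioo_subset_Icc_self hw) hw.1.le
  · simp only [← ha, neg_sub]
    exact hlip w (Ioo_subset_Icc_self hw) a0 (right_mem_Icc.2 hlt.le) hw.2.le

theorem hitProb_eq_exitScale {U : ℝ → ℝ} (hU : Continuous (deriv U)) {c lam : Fin 2 → ℝ}
    (hc : c 1 ≤ c 0) (hlam : ∀ j, 0 < lam j) {l r : ℝ}
    (h : OpposedDrifts (fun j y => c j - deriv U y) l r) {Φ : Fin 2 → ℝ → ℝ}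
    (hΦ : IsTravelTime (fun j y => c j - deriv U y) Φ l r)
    {Ω : Type*} [MeasurableSpace Ω] {P : Measure Ω} [IsProbabilityMeasure P]
    {ξ : ℝ → Ω → Fin 2} (hξ : IsTwoStateMarkov P lam ξ) {x : ℝ} (hx : x ∈ Ioo l r)
    {X : ℝ → Ω → ℝ} (hX : IsTelegraphInPotential P U c ξ x X) {i : Fin 2}
    (hi : P {ω | ξ 0 ω = i} ≠ 0) :
    hitProb P ξ X r i = exitScale (fun j y => c j - deriv U y) Φ lam l r i x := by
  obtain ⟨σ, hσ, hcond, hpath⟩ := hξ.exists_holding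
  obtain ⟨hind, hlaw⟩ := hcond i hi
  set Q := P[|{ω | ξ 0 ω = i}] with hQ
  have hQprob : IsProbabilityMeasure Q := cond_isProbabilityMeasure hi
  have hac : Q ≪ P := cond_absolutelyContinuous
  have hx' := Ioo_subset_Icc_self hx
  have hmeas : MeasurableSet {ω | ξ 0 ω = i} :=
    hξ.measurable 0 le_rfl (measurableSet_singleton i)
  rw [← h.measureReal_exists_stoppedChain_eq hΦ hlam hx' hσ hind hlaw, hitProb, ← hQ]
  refine measureReal_congr ?_
  have hcle : ∀ j, c j ≤ c 0 := fun j => by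
    obtain rfl | rfl : j = 0 ∨ j = 1 := by omega
    · exact le_rfl
    · exact hc
  have hcabs : ∀ j, |c j| ≤ max |c 0| |c 1| := fun j => by
    obtain rfl | rfl : j = 0 ∨ j = 1 := by omega
    · exact le_max_left _ _
    · exact le_max_right _ _
  filter_upwards [hac.ae_le hpath, hac.ae_le hX.solves, ae_cond_mem hmeas,
    ae_forall_holding_pos hlam hσ hlaw, ae_tendsto_sum_holding hlam hσ hind hlaw,
    h.ae_exists_stoppedChain_notMem hΦ hlam hx' hσ hind hlaw] with ω h1 h2 h3 h4 h5 h6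
  obtain ⟨hXc, hXsol⟩ := h2
  have h3' : ξ 0 ω = i := h3
  rw [h3'] at h1
  -- Freezing the path at negative times makes it continuous on the whole line, as the pathwise
  -- lemmas require.
  set f : ℝ → ℝ := fun t => X (max t 0) ω with hf
  have hfX : ∀ t, 0 ≤ t → f t = X t ω := fun t ht => by simp only [hf, max_eq_left ht]
  have hfc : Continuous f :=
    hXc.comp_continuous (continuous_id.max continuous_const) fun t => le_max_right t 0
  have hw : ∀ a b, 0 ≤ a → 0 ≤ b → IntervalIntegrable (fun s => c (ξ s ω)) volume a b :=
    fun a b ha hb => intervalIntegrable_of_piecewise_const (d := fun n => c (alternate i n))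
      (by simp) h5 (fun n t ht ht' => by rw [h1 n t ht ht']) (fun t => hcabs _) ha hb
  have hsol : ∀ t, 0 ≤ t → f t = x - (∫ s in (0 : ℝ)..t, deriv U (f s)) +
      ∫ s in (0 : ℝ)..t, c (ξ s ω) := fun t ht => by
    rw [hfX t ht, hXsol t ht, telegraph]
    congr 2
    refine intervalIntegral.integral_congr fun s hs => ?_
    rw [uIcc_of_le ht] at hs
    simp only [hfX s hs.1]
  have hincr : ∀ s t, 0 ≤ s → 0 ≤ t → f t - f s = ∫ u in s..t, (c (ξ u ω) - deriv U (f u)) :=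
    fun s t hs ht => sub_eq_integral_of_solves hfc hU hw hsol hs ht
  have hS : ∀ n, 0 ≤ ∑ k ∈ Finset.range n, σ k ω :=
    fun n => Finset.sum_nonneg fun k _ => (h4 k).le
  have hiff := h.exists_stoppedChain_eq_iff hΦ (i := i) hx (fun n => (h4 n).le) hfc
    (by simpa using hsol 0 le_rfl)
    (fun n t ht => hasDerivAt_of_sub_eq_integral (w := fun s => c (ξ s ω)) hfc hU
      (fun s hs => hincr _ s (hS n) ((hS n).trans hs.1.le))
      (fun s hs hs' => by rw [h1 n s hs hs']) ht)
    -- Since `c j ≤ c 0`, the actual drift never exceeds that of state 0.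
    (fun s t hs hst => by
      rw [hincr s t hs (hs.trans hst)]
      exact intervalIntegral.integral_mono_on hst
        ((hw s t hs (hs.trans hst)).sub ((hU.comp hfc).intervalIntegrable _ _))
        ((continuous_const.sub (hU.comp hfc)).intervalIntegrable _ _)
        fun u _ => sub_le_sub_right (hcle _) _)
    h6
  refine propext ?_
  change firstPassage X r ω < ⊤ ↔ ∃ n, stoppedChain Φ l r i x (fun k => σ k ω) n = r
  rw [hiff, firstPassage_lt_top_iff]
  exact exists_congr fun t => and_congr_right fun ht => by rw [hfX t ht.le]

theorem mainTheorem1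
    (U : ℝ → ℝ) (xm x0 xp : ℝ) (hU : IsDoubleWell U xm x0 xp)
    (c : Fin 2 → ℝ) (V v am a0 ap bm b0 bp : ℝ)
    (hreg : IsSmallVelocityRegime U c V v am a0 ap bm b0 bp)
    (lam : Fin 2 → ℝ) (hlam : ∀ i, 0 < lam i)
    (Φ : Fin 2 → ℝ → ℝ)
    (hΦ : ∀ i, ∀ y ∈ Set.Ioo b0 a0, HasDerivAt (Φ i) (1 / (c i - deriv U y)) y)
    {Ω : Type*} [MeasurableSpace Ω] (P : MeasureTheory.Measure Ω)
    [MeasureTheory.IsProbabilityMeasure P]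
    (ξ : ℝ → Ω → Fin 2) (hξ : IsTwoStateMarkov P lam ξ)
    (x : ℝ) (hx : x ∈ Set.Ioo b0 a0)
    (X : ℝ → Ω → ℝ) (hX : IsTelegraphInPotential P U c ξ x X) :
    (∀ i, MeasureTheory.IntegrableOn (exitDensity U c lam Φ i) (Set.Ioo b0 a0)) ∧
    (∀ i, exitB U c lam Φ b0 a0 i ≠ 0) ∧
    (P {ω | ξ 0 ω = 0} ≠ 0 →
      hitProb P ξ X a0 0 =
        1 - (exitB U c lam Φ b0 a0 0)⁻¹ * ∫ y in x..a0, exitDensity U c lam Φ 0 y) ∧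
    (P {ω | ξ 0 ω = 1} ≠ 0 →
      hitProb P ξ X a0 1 =
        (exitB U c lam Φ b0 a0 1)⁻¹ * ∫ y in b0..x, exitDensity U c lam Φ 1 y) := by
  have hU' : ContDiff ℝ 1 (deriv U) := ((contDiff_succ_iff_deriv (n := 1)).1 hU.contDiff).2.2
  have h := hreg.opposedDrifts hU' (hx.1.trans hx.2)
  have hΦ' : IsTravelTime (fun j y => c j - deriv U y) Φ b0 a0 := hΦ
  have hB : ∀ i, exitB U c lam Φ b0 a0 i ≠ 0 := h.integral_ne_zero hΦ' hlam
  have hscale : ∀ i, exitScale (fun j y => c j - deriv U y) Φ lam b0 a0 i x =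
      (exitB U c lam Φ b0 a0 i)⁻¹ * ∫ y in b0..x, exitDensity U c lam Φ i y :=
    fun i => OpposedDrifts.exitScale_eq i (Ioo_subset_Icc_self hx)
  refine ⟨h.integrableOn_psi_div hΦ' hlam, hB, fun hi => ?_, fun hi => ?_⟩
  · rw [hitProb_eq_exitScale hU'.continuous hreg.c_lt.le hlam h hΦ' hξ hx hX hi, hscale]
    have hint := fun {a b : ℝ} => h.intervalIntegrable_psi_div hΦ' hlam 0 (a := a) (b := b)
    have hsplit : (∫ y in b0..x, exitDensity U c lam Φ 0 y) +
        ∫ y in x..a0, exitDensity U c lam Φ 0 y = exitB U c lam Φ b0 a0 0 :=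
      intervalIntegral.integral_add_adjacent_intervals
        (hint (left_mem_Icc.2 h.lt.le) (Ioo_subset_Icc_self hx))
        (hint (Ioo_subset_Icc_self hx) (right_mem_Icc.2 h.lt.le))
    rw [eq_sub_iff_add_eq, ← mul_add, hsplit, inv_mul_cancel₀ (hB 0)]
  · rw [hitProb_eq_exitScale hU'.continuous hreg.c_lt.le hlam h hΦ' hξ hx hX hi, hscale]
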